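/- Let $M$ be a smooth $n$-dimensional manifold with a torsion-free smooth connection $\hat\nabla$ on $TM$, let $E\to M$ be a smooth real vector bundle of finite rank with a smooth connection $\nabla$, and let $p\in M$. Write $\otimes(W)$, $S(W)$, $\wedge(W)$ for the tensor, symmetric and exterior algebras of a real vector space $W$, and $\boxtimes$ for the tensor product over $\mathbb R$. Let $\nabla$ also denote the connections induced on $\wedge(E^*)$ and on $\mathrm{Hom}(TM\otimes TM\otimes E,E)$ by duality and the Leibniz rule, using $\hat\nabla$ on $TM$. For smooth vector fields $X_0,\dots,X_j$ define the higher covariant derivatives on sections by $\nabla^0=\mathrm{id}$ and $$\nabla^{j+1}_{X_0,\dots,X_j}=\nabla_{X_0}\circ\nabla^{j}_{X_1,\dots,X_j}-\sum_{k=1}^{j}\nabla^{j}_{X_1,\dots,\hat\nabla_{X_0}X_k,\dots,X_j},$$ and let $R^E_{X,Y}=\nabla^2_{X,Y}-\nabla^2_{Y,X}$ be the curvature of $E$; $R^{TM}$ is the curvature of $\hat\nabla$. Define the linear map $$\Phi_p:\otimes(T_pM)\boxtimes\wedge(E_p)\to[C^\infty(\wedge(E^*))]^*,\qquad \Phi_p\big((v_1\otimes\cdots\otimes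 v_j)\boxtimes\alpha\big)(\omega)=\big(\nabla^j_{\tilde v_1,\dots,\tilde v_j}\omega\big)_p(\alpha),$$ where $\tilde v_i$ is any smooth vector field on $M$ with $\tilde v_i(p)=v_i$ and the pairing of $\wedge(E_p^*)$ with $\wedge(E_p)$ is the determinant pairing. Let $\mathcal U_k^r(E;p)$ be the image under $\Phi_p$ of $\otimes^{\le r}(T_pM)\boxtimes\wedge^k(E_p)$, and let $\mathcal U(E;p)=\sum_{r,k}\mathcal U_k^r(E;p)$. The following are equivalent: 1. $\ker(\Phi_p)$ is a two-sided ideal of the algebra $\otimes(T_pM)\boxtimes\wedge(E_p)$; 2. $M$ and $E$ are asymptotically flat at $p$, that is, $(\hat\nabla^jR^{TM})(p)=0$ and $(\nabla^jR^E)(p)=0$ for all $j\ge 0$; 3. $\Phi_p$ factors through the natural projection $\otimes(T_pM)\boxtimes\wedge(E_p)\to S(T_pM)\boxtimes\wedge(E_p)$. If any of these holds, then $\Phi_p$ descends to a linear isomorphism $S(T_pM)\boxtimes\wedge(E_p)\cong\mathcal U(E;p)$, and this isomorphism maps $S^{\le r}(T_pM)\boxtimes\wedge^k(E_p)$ onto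 $\mathcal U_k^r(E;p)$ for all $r,k\ge 0$. -/

import Mathlib

open Bundle Function
open scoped Manifold ContDiff Topology TensorProduct

set_option linter.unusedSectionVars false

noncomputable section

namespace CovJet

section Sections

variable {B : Type*} [NormedAddCommGroup B] [NormedSpace ℝ B]
  {M : Type*} [TopologicalSpace M] [ChartedSpace B M]

variable (B M) in
/-- Smooth vector fields on `M`. -/
abbrev VecField [IsManifold 𝓘(ℝ, B) ∞ M] : Type _ :=
  Cₛ^∞⟮𝓘(ℝ, B); B, (TangentSpace 𝓘(ℝ, B) : M → Type _)⟯

variable [IsManifold 𝓘(ℝ, B) ∞ M]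

/-- The derivative `X f` of a smooth function along a smooth vector field. -/
def dirDeriv (X : VecField B M) (f : C^∞⟮𝓘(ℝ, B), M; ℝ⟯) : C^∞⟮𝓘(ℝ, B), M; ℝ⟯ :=
  ⟨fun x ↦ mvfderiv 𝓘(ℝ, B) f x (X x), by
    have h := (contMDiff_snd_tangentBundle_modelSpace ℝ 𝓘(ℝ, ℝ) (n := ∞)).comp
      ((f.contMDiff.contMDiff_tangentMap (m := ∞) le_rfl).comp X.contMDiff)
    exact h⟩

theorem dirDeriv_add_left (X Y : VecField B M) (f : C^∞⟮𝓘(ℝ, B), M; ℝ⟯) :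
    dirDeriv (X + Y) f = dirDeriv X f + dirDeriv Y f := by
  ext x; exact (mvfderiv 𝓘(ℝ, B) f x).map_add (X x) (Y x)

theorem dirDeriv_smul_left (c : ℝ) (X : VecField B M) (f : C^∞⟮𝓘(ℝ, B), M; ℝ⟯) :
    dirDeriv (c • X) f = c • dirDeriv X f := by
  ext x; exact (mvfderiv 𝓘(ℝ, B) f x).map_smul c (X x)

theorem mdiff (f : C^∞⟮𝓘(ℝ, B), M; ℝ⟯) (x : M) : MDifferentiableAt 𝓘(ℝ, B) 𝓘(ℝ, ℝ) f x :=
  f.contMDiff.mdifferentiable (by simp) x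

theorem dirDeriv_add (X : VecField B M) (f g : C^∞⟮𝓘(ℝ, B), M; ℝ⟯) :
    dirDeriv X (f + g) = dirDeriv X f + dirDeriv X g := by
  ext x
  exact congrArg (· (X x)) (mvfderiv_add (mdiff f x) (mdiff g x))

theorem dirDeriv_mul (X : VecField B M) (f g : C^∞⟮𝓘(ℝ, B), M; ℝ⟯) :
    dirDeriv X (f * g) = f * dirDeriv X g + dirDeriv X f * g := by
  ext x
  have := congrArg (· (X x)) (mvfderiv_mul (mdiff f x) (mdiff g x))
  refine this.trans ?_
  change f x * mvfderiv 𝓘(ℝ, B) g x (X x) + g x * mvfderiv 𝓘(ℝ, B) f x (X x) =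
    f x * mvfderiv 𝓘(ℝ, B) g x (X x) + mvfderiv 𝓘(ℝ, B) f x (X x) * g x
  ring

theorem dirDeriv_smul (c : ℝ) (X : VecField B M) (f : C^∞⟮𝓘(ℝ, B), M; ℝ⟯) :
    dirDeriv X (c • f) = c • dirDeriv X f := by
  ext x
  have := congrArg (· (X x)) (mvfderiv_mul (I := 𝓘(ℝ, B)) (f := fun _ ↦ c)
    mdifferentiableAt_const (mdiff f x))
  refine this.trans ?_
  rw [mvfderiv_const, smul_zero, add_zero]
  rfl

variable {F : Type*} [NormedAddCommGroup F] [NormedSpace ℝ F]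
  {V : M → Type*} [TopologicalSpace (TotalSpace F V)]
  [∀ x, AddCommGroup (V x)] [∀ x, Module ℝ (V x)] [∀ x, TopologicalSpace (V x)]
  [FiberBundle F V] [VectorBundle ℝ F V]

variable (B F V) in
/-- Smooth sections of the bundle `V`. -/
abbrev Sec : Type _ := Cₛ^∞⟮𝓘(ℝ, B); F, V⟯

/-- The product of a smooth function and a smooth section. -/
def fmul (f : C^∞⟮𝓘(ℝ, B), M; ℝ⟯) (s : Sec B F V) : Sec B F V :=
  ⟨(f : M → ℝ) • (s : Π x, V x), f.contMDiff.smul_section s.contMDiff⟩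

theorem dirDeriv_fmul_left (f : C^∞⟮𝓘(ℝ, B), M; ℝ⟯) (X : VecField B M)
    (g : C^∞⟮𝓘(ℝ, B), M; ℝ⟯) : dirDeriv (fmul f X) g = f * dirDeriv X g := by
  ext x; exact (mvfderiv 𝓘(ℝ, B) g x).map_smul (f x) (X x)

variable (B F) in
/-- Evaluation of smooth sections at a point. -/
def evalAt (x : M) : Sec B F V →ₗ[ℝ] V x where
  toFun s := s x
  map_add' _ _ := rfl
  map_smul' _ _ := rfl

theorem sec_mdiff (s : Sec B F V) (x : M) :
    MDifferentiableAt 𝓘(ℝ, B) (𝓘(ℝ, B).prod 𝓘(ℝ, F))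
      (fun y ↦ TotalSpace.mk' F y (s y)) x :=
  s.contMDiff.mdifferentiable (by simp) x

section Extension

variable [FiniteDimensional ℝ B] [FiniteDimensional ℝ F] [T2Space M]
  [ContMDiffVectorBundle ∞ F V 𝓘(ℝ, B)]

/-- Around each point there are finitely many global smooth sections and a cut-off function `χ`
such that each section, multiplied by `χ ^ 2`, is a combination of these sections, with
coefficients at the given point that depend only on the value there. -/
theorem exists_frame (x : M) :
    ∃ (e : Fin (Module.finrank ℝ F) → Sec B F V) (χ : C^∞⟮𝓘(ℝ, B), M; ℝ⟯), χ x = 1 ∧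
      (∀ v : V x, ∃ a : Fin (Module.finrank ℝ F) → ℝ, v = ∑ i, a i • e i x) ∧
      ∀ s : Sec B F V, ∃ c : Fin (Module.finrank ℝ F) → C^∞⟮𝓘(ℝ, B), M; ℝ⟯,
        fmul (χ * χ) s = ∑ i, fmul (c i) (e i) ∧ (s x = 0 → ∀ i, c i x = 0) := by
  have : ContMDiffVectorBundle 1 F V 𝓘(ℝ, B) := ContMDiffVectorBundle.of_le (n := ∞) (by simp)
  let t := trivializationAt F V x
  let b := Module.finBasis ℝ F
  have hx : x ∈ t.baseSet := FiberBundle.mem_baseSet_trivializationAt F V x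
  obtain ⟨ρ, -, hρ⟩ := (SmoothBumpFunction.nhds_basis_tsupport (I := 𝓘(ℝ, B)) x).mem_iff.1
    (t.open_baseSet.mem_nhds hx)
  let χ : C^∞⟮𝓘(ℝ, B), M; ℝ⟯ := ⟨ρ, ρ.contMDiff⟩
  let e : Fin (Module.finrank ℝ F) → Sec B F V := fun i ↦
    ⟨(ρ : M → ℝ) • t.localFrame b i, ContMDiffOn.smul_section_of_tsupport
      ρ.contMDiff.contMDiffOn t.open_baseSet hρ (t.contMDiffOn_localFrame_baseSet ∞ b i)⟩
  have hρx : ρ x = 1 := ρ.eq_one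
  refine ⟨e, χ, hρx, fun v ↦ ?_, fun s ↦ ?_⟩
  · refine ⟨fun i ↦ (t.basisAt b hx).repr v i, ?_⟩
    conv_lhs => rw [← (t.basisAt b hx).sum_repr v]
    refine Finset.sum_congr rfl fun i _ ↦ ?_
    change _ = _ • (ρ x • t.localFrame b i x)
    rw [hρx, one_smul, t.localFrame_apply_of_mem_baseSet b hx]
  · have hc : ∀ i, ContMDiff 𝓘(ℝ, B) 𝓘(ℝ, ℝ) ∞
        (fun y ↦ ρ y * t.localFrameCoeff 𝓘(ℝ, B) b i y (s y)) := by
      intro i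
      have h1 := contMDiffOn_baseSet_localFrameCoeff (e := t) b (k := ∞) (s := fun y ↦ s y)
        (s.contMDiff.contMDiffOn) i
      refine contMDiff_of_tsupport fun y hy ↦ ?_
      have hy' : y ∈ t.baseSet := hρ (tsupport_mul_subset_left hy)
      exact ρ.contMDiff.contMDiffAt.mul ((h1 y hy').contMDiffAt (t.open_baseSet.mem_nhds hy'))
    refine ⟨fun i ↦ ⟨_, hc i⟩, ?_, ?_⟩
    · ext y
      rw [show (∑ i, fmul (⟨_, hc i⟩ : C^∞⟮𝓘(ℝ, B), M; ℝ⟯) (e i)) y =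
        ∑ i, evalAt B F y (fmul (⟨_, hc i⟩ : C^∞⟮𝓘(ℝ, B), M; ℝ⟯) (e i)) from
          map_sum (evalAt B F y) _ _]
      change (ρ y * ρ y) • s y =
        ∑ i, (ρ y * t.localFrameCoeff 𝓘(ℝ, B) b i y (s y)) • (ρ y • t.localFrame b i y)
      by_cases hy : y ∈ t.baseSet
      · conv_lhs => rw [t.eq_sum_localFrameCoeff_smul (I := 𝓘(ℝ, B)) (b := b) (s := s) hy]
        rw [Finset.smul_sum]
        refine Finset.sum_congr rfl fun i _ ↦ ?_
        simp only [smul_smul]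
        congr 1
        ring
      · have : ρ y = 0 := by
          by_contra h
          exact hy (hρ (subset_tsupport _ h))
        simp [this]
    · intro h i
      change ρ x * t.localFrameCoeff 𝓘(ℝ, B) b i x (s x) = 0
      rw [h, map_zero, mul_zero]

theorem sec_sum_apply {ι : Type*} (t : Finset ι) (s : ι → Sec B F V) (x : M) :
    (∑ i ∈ t, s i) x = ∑ i ∈ t, s i x := map_sum (evalAt B F x) _ _

theorem evalAt_surjective (x : M) : Surjective (evalAt B F (V := V) x) := by
  obtain ⟨e, -, -, h, -⟩ := exists_frame (B := B) (F := F) (V := V) x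
  intro v
  obtain ⟨a, ha⟩ := h v
  exact ⟨∑ i, a i • e i, by rw [map_sum, ha]; rfl⟩

/-- A choice of smooth extensions of the vectors in the fibre over `x`, linear in the vector. -/
def extSec (x : M) : V x →ₗ[ℝ] Sec B F V :=
  ((evalAt B F x).exists_rightInverse_of_surjective
    (LinearMap.range_eq_top.2 (evalAt_surjective x))).choose

@[simp]
theorem extSec_apply_self (x : M) (v : V x) : (extSec x v : Sec B F V) x = v :=
  LinearMap.congr_fun ((evalAt B F x).exists_rightInverse_of_surjective
    (LinearMap.range_eq_top.2 (evalAt_surjective x))).choose_spec v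

/-- A linear operation that is tensorial at `x` vanishes on the sections that vanish at `x`. -/
theorem tensorial_zero {x : M} {W : Type*} [AddCommGroup W] [Module ℝ W]
    (L : Sec B F V →ₗ[ℝ] W) (hL : ∀ f s, L (fmul f s) = f x • L s)
    (s : Sec B F V) (hs : s x = 0) : L s = 0 := by
  obtain ⟨e, χ, hχ, -, h⟩ := exists_frame (B := B) (F := F) (V := V) x
  obtain ⟨c, hc, h0⟩ := h s
  have h1 : L (fmul (χ * χ) s) = L s := by rw [hL]; simp [hχ]
  rw [← h1, hc, map_sum]
  exact Finset.sum_eq_zero fun i _ ↦ by rw [hL, h0 hs i, zero_smul]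

/-- A multilinear operation that is tensorial at `x` depends only on the values at `x`. -/
theorem tensorial_congr {x : M} {W : Type*} [AddCommGroup W] [Module ℝ W] {k : ℕ}
    (L : MultilinearMap ℝ (fun _ : Fin k ↦ Sec B F V) W)
    (hL : ∀ Y i f, L (update Y i (fmul f (Y i))) = f x • L Y)
    (Y Z : Fin k → Sec B F V) (h : ∀ i, Y i x = Z i x) : L Y = L Z := by
  classical
  suffices H : ∀ t : Finset (Fin k), L (fun i ↦ if i ∈ t then Z i else Y i) = L Y by
    simpa using (H Finset.univ).symm
  intro t
  induction t using Finset.induction_on with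
  | empty => simp
  | insert a t ha ih =>
    rw [← ih]
    set W := (fun i ↦ if i ∈ t then Z i else Y i) with hW
    have e1 : (fun i ↦ if i ∈ insert a t then Z i else Y i) = update W a (Z a) := by
      ext1 i
      by_cases hi : i = a
      · subst hi; simp
      · simp [hi, hW]
    have e2 : W = update W a (Y a) := by
      ext1 i
      by_cases hi : i = a
      · subst hi; simp [hW, ha]
      · simp [hi]
    rw [e1]
    conv_rhs => rw [e2]
    rw [← sub_eq_zero, ← L.map_update_sub]
    refine tensorial_zero (x := x) (L.toLinearMap W a) (fun f s ↦ ?_) _ ?_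
    · simpa using hL (update W a s) a f
    · exact sub_eq_zero.2 (h a).symm

end Extension

end Sections

section Connections

variable {B : Type*} [NormedAddCommGroup B] [NormedSpace ℝ B]
  {M : Type*} [TopologicalSpace M] [ChartedSpace B M] [IsManifold 𝓘(ℝ, B) ∞ M]
  {F : Type*} [NormedAddCommGroup F] [NormedSpace ℝ F]
  {V : M → Type*} [TopologicalSpace (TotalSpace F V)]
  [∀ x, AddCommGroup (V x)] [∀ x, Module ℝ (V x)] [∀ x, TopologicalSpace (V x)]
  [∀ x, IsTopologicalAddGroup (V x)] [∀ x, ContinuousSMul ℝ (V x)]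
  [FiberBundle F V] [VectorBundle ℝ F V]

/-- The operator `(X, s) ↦ ∇_X s` of a smooth connection on smooth vector fields and smooth
sections. -/
def nabla [ContMDiffVectorBundle ∞ F V 𝓘(ℝ, B)]
    (cov : CovariantDerivative 𝓘(ℝ, B) F V)
    [hcov : CovariantDerivative.ContMDiffCovariantDerivative cov ∞]
    (X : VecField B M) (s : Sec B F V) : Sec B F V :=
  ⟨fun x ↦ cov s x (X x), by
    have h := hcov.contMDiff.contMDiff (σ := s) s.contMDiff.contMDiffOn
    exact (contMDiffOn_univ.1 h).clm_bundle_apply X.contMDiff⟩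

variable [ContMDiffVectorBundle ∞ F V 𝓘(ℝ, B)]
  (cov : CovariantDerivative 𝓘(ℝ, B) F V)
  [hcov : CovariantDerivative.ContMDiffCovariantDerivative cov ∞]

theorem nabla_add_left (X Y : VecField B M) (s : Sec B F V) :
    nabla cov (X + Y) s = nabla cov X s + nabla cov Y s := by
  ext x; exact (cov s x).map_add (X x) (Y x)

theorem nabla_smul_left (c : ℝ) (X : VecField B M) (s : Sec B F V) :
    nabla cov (c • X) s = c • nabla cov X s := by
  ext x; exact (cov s x).map_smul c (X x)

theorem nabla_fmul_left (f : C^∞⟮𝓘(ℝ, B), M; ℝ⟯) (X : VecField B M) (s : Sec B F V) :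
    nabla cov (fmul f X) s = fmul f (nabla cov X s) := by
  ext x; exact (cov s x).map_smul (f x) (X x)

theorem nabla_add (X : VecField B M) (s t : Sec B F V) :
    nabla cov X (s + t) = nabla cov X s + nabla cov X t := by
  ext x
  exact congrArg (· (X x)) (cov.isCovariantDerivativeOnUniv.add (sec_mdiff s x) (sec_mdiff t x))

theorem nabla_fmul (X : VecField B M) (f : C^∞⟮𝓘(ℝ, B), M; ℝ⟯) (s : Sec B F V) :
    nabla cov X (fmul f s) = fmul f (nabla cov X s) + fmul (dirDeriv X f) s := by
  ext x
  exact congrArg (· (X x)) (cov.isCovariantDerivativeOnUniv.leibniz (sec_mdiff s x) (mdiff f x))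

theorem nabla_smul (X : VecField B M) (c : ℝ) (s : Sec B F V) :
    nabla cov X (c • s) = c • nabla cov X s := by
  ext x
  exact congrArg (· (X x)) (cov.isCovariantDerivativeOnUniv.smul_const c (sec_mdiff s x))

/-- `nabla` as a linear map in the section. -/
def nablaLin (X : VecField B M) : Sec B F V →ₗ[ℝ] Sec B F V where
  toFun := nabla cov X
  map_add' := nabla_add cov X
  map_smul' := nabla_smul cov X

end Connections

section HigherDerivative

variable {X G : Type*} [AddCommGroup X] [AddCommGroup G]

/-- The higher covariant derivative `∇^j_{Y₁,…,Y_j} s`, given a connection `nT` on vector fields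
and a connection `n` on sections:
`∇^{j+1}_{Y₀,…,Y_j} = ∇_{Y₀} ∘ ∇^j_{Y₁,…,Y_j} - ∑ₖ ∇^j_{Y₁,…,∇_{Y₀}Yₖ,…,Y_j}`. -/
def higher (nT : X → X → X) (n : X → G → G) : (j : ℕ) → (Fin j → X) → G → G
  | 0, _, s => s
  | j + 1, Y, s => n (Y 0) (higher nT n j (Fin.tail Y) s) -
      ∑ k : Fin j, higher nT n j (update (Fin.tail Y) k (nT (Y 0) (Fin.tail Y k))) s

section Linearity

variable [Module ℝ X] [Module ℝ G] (nT : X →ₗ[ℝ] X →ₗ[ℝ] X) (n : X →ₗ[ℝ] G →ₗ[ℝ] G)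

theorem higher_add_smul (j : ℕ) (Y : Fin j → X) (c : ℝ) (s t : G) :
    higher (fun a b ↦ nT a b) (fun a b ↦ n a b) j Y (s + c • t) =
      higher (fun a b ↦ nT a b) (fun a b ↦ n a b) j Y s +
        c • higher (fun a b ↦ nT a b) (fun a b ↦ n a b) j Y t := by
  induction j with
  | zero => rfl
  | succ j ih =>
    simp only [higher, ih, map_add, map_smul, Finset.sum_add_distrib, ← Finset.smul_sum, smul_sub]
    abel

theorem higher_update (j : ℕ) (Y : Fin j → X) (i : Fin j) (c : ℝ) (a b : X) (s : G) :
    higher (fun a b ↦ nT a b) (fun a b ↦ n a b) j (update Y i (a + c • b)) s =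
      higher (fun a b ↦ nT a b) (fun a b ↦ n a b) j (update Y i a) s +
        c • higher (fun a b ↦ nT a b) (fun a b ↦ n a b) j (update Y i b) s := by
  induction j generalizing a b with
  | zero => exact i.elim0
  | succ j ih =>
    refine Fin.cases ?_ (fun i ↦ ?_) i
    · simp only [higher, Fin.tail_update_zero, update_self, map_add, map_smul,
        LinearMap.add_apply, LinearMap.smul_apply, ih, Finset.sum_add_distrib, ← Finset.smul_sum,
        smul_sub]
      abel
    · have h0 : ∀ x : X, update Y i.succ x 0 = Y 0 := fun x ↦
        update_of_ne (Fin.succ_ne_zero i).symm _ _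
      have key : ∀ x : X, higher (fun a b ↦ nT a b) (fun a b ↦ n a b) (j + 1)
          (update Y i.succ x) s =
          n (Y 0) (higher (fun a b ↦ nT a b) (fun a b ↦ n a b) j (update (Fin.tail Y) i x) s) -
          (higher (fun a b ↦ nT a b) (fun a b ↦ n a b) j
              (update (Fin.tail Y) i (nT (Y 0) x)) s +
            ∑ k ∈ Finset.univ.erase i, higher (fun a b ↦ nT a b) (fun a b ↦ n a b) j
              (update (update (Fin.tail Y) k (nT (Y 0) (Fin.tail Y k))) i x) s) := by
        intro x
        rw [higher, h0, Fin.tail_update_succ, ← Finset.add_sum_erase _ _ (Finset.mem_univ i)]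
        congr 2
        · simp
        · refine Finset.sum_congr rfl fun l hl ↦ ?_
          have hl' : l ≠ i := Finset.ne_of_mem_erase hl
          rw [update_of_ne hl', update_comm hl']
      simp only [key, ih, map_add, map_smul, Finset.sum_add_distrib, ← Finset.smul_sum, smul_sub,
        smul_add]
      abel

/-- The higher covariant derivative as a multilinear map. -/
def higherMul (j : ℕ) : MultilinearMap ℝ (fun _ : Fin j ↦ X) (G →ₗ[ℝ] G) where
  toFun Y :=
    { toFun := higher (fun a b ↦ nT a b) (fun a b ↦ n a b) j Y
      map_add' := fun s t ↦ by simpa using higher_add_smul nT n j Y 1 s t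
      map_smul' := fun c t ↦ by
        have h0 := higher_add_smul nT n j Y 1 0 0
        have h := higher_add_smul nT n j Y c 0 t
        simp only [one_smul, add_zero, left_eq_add, zero_add] at h0 h
        simpa [h0] using h }
  map_update_add' := by
    intro inst Y i a b
    obtain rfl : inst = instDecidableEqFin j := Subsingleton.elim _ _
    ext s
    have := higher_update nT n j Y i 1 a b s
    rw [one_smul, one_smul] at this
    exact this
  map_update_smul' := by
    intro inst Y i c b
    obtain rfl : inst = instDecidableEqFin j := Subsingleton.elim _ _
    ext s
    have h0 := higher_update nT n j Y i 1 0 0 s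
    have h := higher_update nT n j Y i c 0 b s
    simp only [one_smul, add_zero, left_eq_add, zero_add] at h0 h
    rw [h0, zero_add] at h
    exact h

/-- If both connections satisfy the Leibniz rule, then the higher covariant derivative is
tensorial in the vector fields. -/
theorem higher_tensorial {A : Type*} (mX : A → X → X) (mG : A → G →+ G) (d : X → A → A)
    (h1 : ∀ f x y, nT (mX f x) y = mX f (nT x y))
    (h2 : ∀ f x y, nT x (mX f y) = mX f (nT x y) + mX (d x f) y)
    (h3 : ∀ f x s, n (mX f x) s = mG f (n x s))
    (h4 : ∀ f x s, n x (mG f s) = mG f (n x s) + mG (d x f) s)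
    (j : ℕ) (Y : Fin j → X) (i : Fin j) (f : A) (x : X) (s : G) :
    higherMul nT n j (update Y i (mX f x)) s = mG f (higherMul nT n j (update Y i x) s) := by
  have hs : ∀ (j : ℕ) (Y : Fin (j + 1) → X), higherMul nT n (j + 1) Y s =
      n (Y 0) (higherMul nT n j (Fin.tail Y) s) -
        ∑ k : Fin j, higherMul nT n j (update (Fin.tail Y) k (nT (Y 0) (Fin.tail Y k))) s :=
    fun _ _ ↦ rfl
  induction j generalizing f x with
  | zero => exact i.elim0
  | succ j ih =>
    induction i using Fin.cases with
    | zero =>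
      simp only [hs, Fin.tail_update_zero, update_self, h3, h1, ih, map_sub, map_sum]
    | succ i =>
      have h0 : ∀ x : X, update Y i.succ x 0 = Y 0 := fun x ↦
        update_of_ne (Fin.succ_ne_zero i).symm _ _
      have key : ∀ x : X, higherMul nT n (j + 1) (update Y i.succ x) s =
          n (Y 0) (higherMul nT n j (update (Fin.tail Y) i x) s) -
          (higherMul nT n j (update (Fin.tail Y) i (nT (Y 0) x)) s +
            ∑ k ∈ Finset.univ.erase i, higherMul nT n j
              (update (update (Fin.tail Y) k (nT (Y 0) (Fin.tail Y k))) i x) s) := by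
        intro x
        rw [hs, h0, Fin.tail_update_succ, ← Finset.add_sum_erase _ _ (Finset.mem_univ i)]
        congr 2
        · simp
        · refine Finset.sum_congr rfl fun l hl ↦ ?_
          have hl' : l ≠ i := Finset.ne_of_mem_erase hl
          rw [update_of_ne hl', update_comm hl']
      simp only [key, ih, h2, h4, MultilinearMap.map_update_add, LinearMap.add_apply, map_sub,
        map_add, map_sum]
      abel

end Linearity

end HigherDerivative

section Curvature

variable {B : Type*} [NormedAddCommGroup B] [NormedSpace ℝ B]
  {M : Type*} [TopologicalSpace M] [ChartedSpace B M] [IsManifold 𝓘(ℝ, B) ∞ M]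
  {F : Type*} [NormedAddCommGroup F] [NormedSpace ℝ F]
  {V : M → Type*} [TopologicalSpace (TotalSpace F V)]
  [∀ x, AddCommGroup (V x)] [∀ x, Module ℝ (V x)] [∀ x, TopologicalSpace (V x)]
  [∀ x, IsTopologicalAddGroup (V x)] [∀ x, ContinuousSMul ℝ (V x)]
  [FiberBundle F V] [VectorBundle ℝ F V]
  [ContMDiffVectorBundle ∞ F V 𝓘(ℝ, B)]
  (covT : CovariantDerivative 𝓘(ℝ, B) B (TangentSpace 𝓘(ℝ, B) : M → Type _))
  [CovariantDerivative.ContMDiffCovariantDerivative covT ∞]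
  (cov : CovariantDerivative 𝓘(ℝ, B) F V)
  [CovariantDerivative.ContMDiffCovariantDerivative cov ∞]

/-- The curvature `R_{a,b} s = ∇²_{a,b} s - ∇²_{b,a} s`. -/
def curv (a b : VecField B M) (s : Sec B F V) : Sec B F V :=
  higher (nabla covT) (nabla cov) 2 ![a, b] s - higher (nabla covT) (nabla cov) 2 ![b, a] s

/-- The connection induced on the bundle `Hom(TM ⊗ TM ⊗ V, V)`; a section of this bundle is given
by its action on vector fields and sections. -/
def nablaHom (X : VecField B M)
    (T : VecField B M → VecField B M → Sec B F V → Sec B F V) :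
    VecField B M → VecField B M → Sec B F V → Sec B F V :=
  fun a b s ↦ nabla cov X (T a b s) - T (nabla covT X a) b s - T a (nabla covT X b) s -
    T a b (nabla cov X s)

/-- `V` is asymptotically flat at `p`: for each `j`, the tensor `∇^j R` vanishes at `p`. -/
def AsympFlat (p : M) : Prop :=
  ∀ (j : ℕ) (Y : Fin j → VecField B M) (a b : VecField B M) (s : Sec B F V),
    (higher (nabla covT) (nablaHom covT cov) j Y (curv covT cov) a b s) p = 0

end Curvature

section Forms

variable {B : Type*} [NormedAddCommGroup B] [NormedSpace ℝ B]
  {M : Type*} [TopologicalSpace M] [ChartedSpace B M] [IsManifold 𝓘(ℝ, B) ∞ M]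
  {F : Type*} [NormedAddCommGroup F] [NormedSpace ℝ F]
  {V : M → Type*} [TopologicalSpace (TotalSpace F V)]
  [∀ x, AddCommGroup (V x)] [∀ x, Module ℝ (V x)] [∀ x, TopologicalSpace (V x)]
  [FiberBundle F V] [VectorBundle ℝ F V]

variable (B F V) in
/-- Smooth sections of `∧^k(V*)`. The fibre `∧^k(V_x*)` is identified, by the determinant pairing,
with the space of alternating `k`-linear forms on `V_x`; a section is smooth if its values on
smooth sections of `V` are smooth functions. -/
def Forms (k : ℕ) : Submodule ℝ (Π x, V x [⋀^Fin k]→ₗ[ℝ] ℝ) where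
  carrier := {η | ∀ Y : Fin k → Sec B F V,
    ContMDiff 𝓘(ℝ, B) 𝓘(ℝ, ℝ) ∞ fun x ↦ η x fun i ↦ Y i x}
  add_mem' h h' Y := (h Y).add (h' Y)
  zero_mem' _ := contMDiff_const
  smul_mem' _ _ h Y := contMDiff_const.mul (h Y)

/-- The smooth function obtained by applying a form to smooth sections. -/
def formApp {k : ℕ} (η : Forms B F V k) (Y : Fin k → Sec B F V) : C^∞⟮𝓘(ℝ, B), M; ℝ⟯ :=
  ⟨fun x ↦ η.1 x fun i ↦ Y i x, η.2 Y⟩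

theorem update_eval {k : ℕ} (x : M) (Y : Fin k → Sec B F V) (i : Fin k) (s : Sec B F V) :
    (fun j ↦ update Y i s j x) = update (fun j ↦ Y j x) i (s x) := by
  ext1 j
  by_cases h : j = i
  · subst h; simp
  · simp [h]

variable [∀ x, IsTopologicalAddGroup (V x)] [∀ x, ContinuousSMul ℝ (V x)]
  [ContMDiffVectorBundle ∞ F V 𝓘(ℝ, B)]
  (cov : CovariantDerivative 𝓘(ℝ, B) F V)
  [CovariantDerivative.ContMDiffCovariantDerivative cov ∞]

/-- The function `X (η(Y₁,…,Yₖ)) - ∑ᵢ η(Y₁,…,∇_X Yᵢ,…,Yₖ)`. -/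
def formDeriv {k : ℕ} (X : VecField B M) (η : Forms B F V k) (Y : Fin k → Sec B F V) :
    C^∞⟮𝓘(ℝ, B), M; ℝ⟯ :=
  dirDeriv X (formApp η Y) - ∑ i, formApp η (update Y i (nabla cov X (Y i)))

theorem app_update_add {k : ℕ} (η : Forms B F V k) (Y : Fin k → Sec B F V) (i : Fin k)
    (s t : Sec B F V) :
    formApp η (update Y i (s + t)) = formApp η (update Y i s) + formApp η (update Y i t) := by
  ext x
  change η.1 x _ = η.1 x _ + η.1 x _
  rw [update_eval, update_eval, update_eval]
  exact (η.1 x).map_update_add _ _ _ _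

theorem app_update_smul {k : ℕ} (η : Forms B F V k) (Y : Fin k → Sec B F V) (i : Fin k)
    (c : ℝ) (s : Sec B F V) :
    formApp η (update Y i (c • s)) = c • formApp η (update Y i s) := by
  ext x
  change η.1 x _ = c • η.1 x _
  rw [update_eval, update_eval]
  exact (η.1 x).map_update_smul _ _ _ _

theorem app_update_fmul {k : ℕ} (η : Forms B F V k) (Y : Fin k → Sec B F V) (i : Fin k)
    (f : C^∞⟮𝓘(ℝ, B), M; ℝ⟯) (s : Sec B F V) :
    formApp η (update Y i (fmul f s)) = f * formApp η (update Y i s) := by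
  ext x
  change η.1 x _ = f x • η.1 x _
  rw [update_eval, update_eval]
  exact (η.1 x).map_update_smul _ _ _ _

/-- A form as an alternating map on sections. -/
def formAlt {k : ℕ} (η : Forms B F V k) : Sec B F V [⋀^Fin k]→ₗ[ℝ] C^∞⟮𝓘(ℝ, B), M; ℝ⟯ where
  toFun := formApp η
  map_update_add' Y i s t := by
    convert! app_update_add η Y i s t
  map_update_smul' Y i c s := by
    convert! app_update_smul η Y i c s
  map_eq_zero_of_eq' Y i j h hij := by
    ext x
    exact (η.1 x).map_eq_zero_of_eq (fun i ↦ Y i x) (congrArg (fun s : Sec B F V ↦ s x) h) hij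

theorem formDeriv_update {k : ℕ} (X : VecField B M) (η : Forms B F V k) (Y : Fin k → Sec B F V)
    (i : Fin k) (s : Sec B F V) :
    formDeriv cov X η (update Y i s) = dirDeriv X (formApp η (update Y i s)) -
      (formApp η (update Y i (nabla cov X s)) + ∑ l ∈ Finset.univ.erase i,
        formApp η (update (update Y l (nabla cov X (Y l))) i s)) := by
  rw [formDeriv, ← Finset.add_sum_erase _ _ (Finset.mem_univ i)]
  congr 2
  · simp
  · refine Finset.sum_congr rfl fun l hl ↦ ?_
    have hl' : l ≠ i := Finset.ne_of_mem_erase hl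
    rw [update_of_ne hl', update_comm hl']

theorem formDeriv_update_add {k : ℕ} (X : VecField B M) (η : Forms B F V k)
    (Y : Fin k → Sec B F V) (i : Fin k) (s t : Sec B F V) :
    formDeriv cov X η (update Y i (s + t)) =
      formDeriv cov X η (update Y i s) + formDeriv cov X η (update Y i t) := by
  simp only [formDeriv_update, app_update_add, dirDeriv_add, nabla_add, Finset.sum_add_distrib]
  abel

theorem formDeriv_update_smul {k : ℕ} (X : VecField B M) (η : Forms B F V k)
    (Y : Fin k → Sec B F V) (i : Fin k) (c : ℝ) (s : Sec B F V) :
    formDeriv cov X η (update Y i (c • s)) = c • formDeriv cov X η (update Y i s) := by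
  simp only [formDeriv_update, app_update_smul, dirDeriv_smul, nabla_smul, ← Finset.smul_sum,
    smul_sub, smul_add]

theorem formDeriv_update_fmul {k : ℕ} (X : VecField B M) (η : Forms B F V k)
    (Y : Fin k → Sec B F V) (i : Fin k) (f : C^∞⟮𝓘(ℝ, B), M; ℝ⟯) (s : Sec B F V) :
    formDeriv cov X η (update Y i (fmul f s)) = f * formDeriv cov X η (update Y i s) := by
  simp only [formDeriv_update, app_update_fmul, dirDeriv_mul, nabla_fmul, app_update_add,
    ← Finset.mul_sum]
  ring

/-- `formDeriv` as an alternating map on sections. -/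
def formDerivAlt {k : ℕ} (X : VecField B M) (η : Forms B F V k) :
    Sec B F V [⋀^Fin k]→ₗ[ℝ] C^∞⟮𝓘(ℝ, B), M; ℝ⟯ where
  toFun := formDeriv cov X η
  map_update_add' Y i s t := by
    convert! formDeriv_update_add cov X η Y i s t
  map_update_smul' Y i c s := by
    convert! formDeriv_update_smul cov X η Y i c s
  map_eq_zero_of_eq' Y i j h hij := by
    have h0 : formApp η Y = 0 := (formAlt η).map_eq_zero_of_eq Y h hij
    have h1 : dirDeriv X (0 : C^∞⟮𝓘(ℝ, B), M; ℝ⟯) = 0 := by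
      simpa using dirDeriv_smul 0 X (0 : C^∞⟮𝓘(ℝ, B), M; ℝ⟯)
    rw [formDeriv, h0, h1, zero_sub, neg_eq_zero,
      ← Finset.add_sum_erase _ _ (Finset.mem_univ i),
      ← Finset.add_sum_erase _ _ (Finset.mem_erase.2 ⟨hij.symm, Finset.mem_univ j⟩),
      Finset.sum_eq_zero, add_zero]
    · have e : update Y j (nabla cov X (Y j)) =
          update Y i (nabla cov X (Y i)) ∘ Equiv.swap i j := by
        ext1 l
        by_cases hi : l = i
        · subst hi; simp [hij, hij.symm, h]
        · by_cases hj : l = j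
          · subst hj; simp [h]
          · simp [Equiv.swap_apply_of_ne_of_ne hi hj, hi, hj]
      rw [e]
      exact (formAlt η).map_add_swap _ hij
    · intro l hl
      simp only [Finset.mem_erase] at hl
      refine (formAlt η).map_eq_zero_of_eq _ ?_ hij
      rw [update_of_ne hl.2.1.symm, update_of_ne hl.1.symm, h]

section Induced

variable [FiniteDimensional ℝ B] [FiniteDimensional ℝ F] [T2Space M]

/-- Evaluation of smooth functions at a point. -/
def evalFun (x : M) : C^∞⟮𝓘(ℝ, B), M; ℝ⟯ →ₗ[ℝ] ℝ where
  toFun f := f x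
  map_add' _ _ := rfl
  map_smul' _ _ := rfl

/-- The value at `x` of the function `X (η(Y₁,…,Yₖ)) - ∑ᵢ η(Y₁,…,∇_X Yᵢ,…,Yₖ)`, as an alternating
form in the values of the sections `Yᵢ` at `x`. -/
def nablaFormAt {k : ℕ} (X : VecField B M) (η : Forms B F V k) (x : M) :
    V x [⋀^Fin k]→ₗ[ℝ] ℝ :=
  (evalFun x).compAlternatingMap ((formDerivAlt cov X η).compLinearMap (extSec x))

theorem nablaFormAt_apply {k : ℕ} (X : VecField B M) (η : Forms B F V k) (x : M)
    (Y : Fin k → Sec B F V) :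
    nablaFormAt cov X η x (fun i ↦ Y i x) = formDeriv cov X η Y x := by
  refine tensorial_congr (x := x)
    ((evalFun x).compAlternatingMap (formDerivAlt cov X η)).toMultilinearMap ?_
    (fun i ↦ extSec x (Y i x)) Y fun i ↦ by simp
  intro Y i f
  change formDeriv cov X η (update Y i (fmul f (Y i))) x = f x • formDeriv cov X η Y x
  rw [formDeriv_update_fmul, update_eq_self]
  rfl

/-- The connection induced on `∧^k(V*)`:
`(∇_X η)(Y₁,…,Yₖ) = X (η(Y₁,…,Yₖ)) - ∑ᵢ η(Y₁,…,∇_X Yᵢ,…,Yₖ)`. -/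
def nablaForm {k : ℕ} (X : VecField B M) (η : Forms B F V k) : Forms B F V k :=
  ⟨nablaFormAt cov X η, fun Y ↦ by
    simp only [nablaFormAt_apply]
    exact (formDeriv cov X η Y).contMDiff⟩

theorem formApp_nablaForm {k : ℕ} (X : VecField B M) (η : Forms B F V k) (Y : Fin k → Sec B F V) :
    formApp (nablaForm cov X η) Y = formDeriv cov X η Y := by
  ext x; exact nablaFormAt_apply cov X η x Y

theorem form_ext {k : ℕ} {η θ : Forms B F V k} (h : ∀ Y, formApp η Y = formApp θ Y) : η = θ := by
  refine Subtype.ext (funext fun x ↦ AlternatingMap.ext fun v ↦ ?_)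
  have := congrArg (fun f : C^∞⟮𝓘(ℝ, B), M; ℝ⟯ ↦ f x) (h fun i ↦ extSec x (v i))
  simpa [formApp] using this

theorem formApp_add {k : ℕ} (η θ : Forms B F V k) (Y : Fin k → Sec B F V) :
    formApp (η + θ) Y = formApp η Y + formApp θ Y := rfl

theorem formApp_smul {k : ℕ} (c : ℝ) (η : Forms B F V k) (Y : Fin k → Sec B F V) :
    formApp (c • η) Y = c • formApp η Y := rfl

variable (B F V) in
/-- Smooth sections of `∧(V*)`, by degrees; all components of degree above the rank vanish. -/
abbrev AllForms : Type _ := Π k : ℕ, Forms B F V k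

/-- The connection induced on `∧(V*)`. -/
def nablaForms : VecField B M →ₗ[ℝ] AllForms B F V →ₗ[ℝ] AllForms B F V :=
  LinearMap.mk₂ ℝ (fun X η k ↦ nablaForm cov X (η k))
    (fun X Y η ↦ funext fun k ↦ form_ext fun Z ↦ by
      simp only [Pi.add_apply, formApp_add, formApp_nablaForm, formDeriv, dirDeriv_add_left,
        nabla_add_left, app_update_add, Finset.sum_add_distrib]
      abel)
    (fun c X η ↦ funext fun k ↦ form_ext fun Z ↦ by
      simp only [Pi.smul_apply, formApp_smul, formApp_nablaForm, formDeriv, dirDeriv_smul_left,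
        nabla_smul_left, app_update_smul, ← Finset.smul_sum, smul_sub])
    (fun X η θ ↦ funext fun k ↦ form_ext fun Z ↦ by
      simp only [Pi.add_apply, formApp_add, formApp_nablaForm, formDeriv, dirDeriv_add,
        Finset.sum_add_distrib]
      abel)
    (fun c X η ↦ funext fun k ↦ form_ext fun Z ↦ by
      simp only [Pi.smul_apply, formApp_smul, formApp_nablaForm, formDeriv, dirDeriv_smul,
        ← Finset.smul_sum, smul_sub])

/-- The product of a smooth function and a smooth section of `∧(V*)`. -/
def formsMul (f : C^∞⟮𝓘(ℝ, B), M; ℝ⟯) : AllForms B F V →+ AllForms B F V where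
  toFun η k := ⟨fun x ↦ f x • (η k).1 x, fun Y ↦ f.contMDiff.mul ((η k).2 Y)⟩
  map_zero' := funext fun _ ↦ Subtype.ext (funext fun x ↦ smul_zero (f x))
  map_add' _ _ := funext fun _ ↦ Subtype.ext (funext fun x ↦ smul_add (f x) _ _)

theorem formApp_formsMul (f : C^∞⟮𝓘(ℝ, B), M; ℝ⟯) (η : AllForms B F V) (k : ℕ)
    (Y : Fin k → Sec B F V) : formApp (formsMul f η k) Y = f * formApp (η k) Y := rfl

theorem nablaForms_fmul_left (f : C^∞⟮𝓘(ℝ, B), M; ℝ⟯) (X : VecField B M) (η : AllForms B F V) :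
    nablaForms cov (fmul f X) η = formsMul f (nablaForms cov X η) := by
  refine funext fun k ↦ form_ext fun Y ↦ ?_
  rw [formApp_formsMul]
  change formApp (nablaForm cov (fmul f X) (η k)) Y = f * formApp (nablaForm cov X (η k)) Y
  simp only [formApp_nablaForm, formDeriv, nabla_fmul_left, app_update_fmul, dirDeriv_fmul_left,
    ← Finset.mul_sum]
  ring

theorem nablaForms_formsMul (f : C^∞⟮𝓘(ℝ, B), M; ℝ⟯) (X : VecField B M) (η : AllForms B F V) :
    nablaForms cov X (formsMul f η) =
      formsMul f (nablaForms cov X η) + formsMul (dirDeriv X f) η := by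
  refine funext fun k ↦ form_ext fun Y ↦ ?_
  rw [Pi.add_apply, formApp_add, formApp_formsMul, formApp_formsMul]
  change formApp (nablaForm cov X (formsMul f η k)) Y =
    f * formApp (nablaForm cov X (η k)) Y + _
  simp only [formApp_nablaForm, formDeriv, formApp_formsMul, dirDeriv_mul, ← Finset.mul_sum]
  ring

variable (B F) in
/-- The pairing of the value at `p` of a section of `∧(V*)` with an element of `∧(V_p)`, with
`η_p(v₁ ∧ ⋯ ∧ vₖ) = η_p(v₁,…,vₖ)`. -/
def pairAt (p : M) : AllForms B F V →ₗ[ℝ] ExteriorAlgebra ℝ (V p) →ₗ[ℝ] ℝ :=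
  ExteriorAlgebra.liftAlternating ∘ₗ
    LinearMap.pi fun k ↦ LinearMap.proj p ∘ₗ (Forms B F V k).subtype ∘ₗ LinearMap.proj k

end Induced

end Forms

section Phi

variable {B : Type*} [NormedAddCommGroup B] [NormedSpace ℝ B] [FiniteDimensional ℝ B]
  {M : Type*} [TopologicalSpace M] [T2Space M] [ChartedSpace B M] [IsManifold 𝓘(ℝ, B) ∞ M]
  {F : Type*} [NormedAddCommGroup F] [NormedSpace ℝ F] [FiniteDimensional ℝ F]
  {V : M → Type*} [TopologicalSpace (TotalSpace F V)]
  [∀ x, AddCommGroup (V x)] [∀ x, Module ℝ (V x)] [∀ x, TopologicalSpace (V x)]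
  [∀ x, IsTopologicalAddGroup (V x)] [∀ x, ContinuousSMul ℝ (V x)]
  [FiberBundle F V] [VectorBundle ℝ F V]
  [ContMDiffVectorBundle ∞ F V 𝓘(ℝ, B)]
  (covT : CovariantDerivative 𝓘(ℝ, B) B (TangentSpace 𝓘(ℝ, B) : M → Type _))
  [CovariantDerivative.ContMDiffCovariantDerivative covT ∞]
  (cov : CovariantDerivative 𝓘(ℝ, B) F V)
  [CovariantDerivative.ContMDiffCovariantDerivative cov ∞]

/-- The connection on `TM` as a bilinear map on smooth vector fields. -/
def nablaT : VecField B M →ₗ[ℝ] VecField B M →ₗ[ℝ] VecField B M :=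
  LinearMap.mk₂ ℝ (nabla covT) (nabla_add_left covT) (nabla_smul_left covT) (nabla_add covT)
    (fun c X Y ↦ nabla_smul covT X c Y)

/-- The higher covariant derivative `∇^j_{Y₁,…,Y_j}` on sections of `∧(V*)`. -/
abbrev higherForms (j : ℕ) :
    MultilinearMap ℝ (fun _ : Fin j ↦ VecField B M) (AllForms B F V →ₗ[ℝ] AllForms B F V) :=
  higherMul (G := AllForms B F V) (nablaT covT) (nablaForms cov) j

/-- `(v₁,…,v_j) ↦ α ↦ (η ↦ (∇^j_{ṽ₁,…,ṽ_j} η)_p(α))`, where `ṽ` is a smooth extension of `v`. -/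
def phiTerm (p : M) (j : ℕ) :
    MultilinearMap ℝ (fun _ : Fin j ↦ TangentSpace 𝓘(ℝ, B) p)
      (ExteriorAlgebra ℝ (V p) →ₗ[ℝ] Module.Dual ℝ (AllForms B F V)) :=
  (LinearMap.lflip.toLinearMap ∘ₗ LinearMap.llcomp ℝ _ _ _ (pairAt B F p)).compMultilinearMap
    ((higherForms covT cov j).compLinearMap fun _ ↦ extSec p)

/-- The map `Φ_p` from `⊗(T_pM) ⊠ ∧(V_p)` to the dual of the space of smooth sections of
`∧(V*)`. -/
def Phi (p : M) :
    TensorAlgebra ℝ (TangentSpace 𝓘(ℝ, B) p) ⊗[ℝ] ExteriorAlgebra ℝ (V p) →ₗ[ℝ]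
      Module.Dual ℝ (AllForms B F V) :=
  TensorProduct.lift
    (DirectSum.toModule ℝ ℕ _ (fun j ↦ PiTensorProduct.lift (phiTerm covT cov p j)) ∘ₗ
      (TensorAlgebra.equivDirectSum (R := ℝ)
        (M := TangentSpace 𝓘(ℝ, B) p)).toLinearMap)

/-- The defining formula of `Φ_p`, for arbitrary smooth extensions `Y` of the tangent vectors. -/
theorem Phi_apply (p : M) {j : ℕ} (v : Fin j → TangentSpace 𝓘(ℝ, B) p)
    (Y : Fin j → VecField B M) (hY : ∀ i, Y i p = v i) (α : ExteriorAlgebra ℝ (V p))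
    (η : AllForms B F V) :
    Phi covT cov p (TensorAlgebra.tprod ℝ _ j v ⊗ₜ α) η =
      pairAt B F p (higherForms covT cov j Y η) α := by
  have h1 : Phi covT cov p (TensorAlgebra.tprod ℝ _ j v ⊗ₜ α) η =
      pairAt B F p (higherForms covT cov j (fun i ↦ extSec p (v i)) η) α := by
    rw [Phi, TensorProduct.lift.tmul, LinearMap.comp_apply]
    have : (TensorAlgebra.equivDirectSum (R := ℝ) (M := TangentSpace 𝓘(ℝ, B) p)).toLinearMap
        (TensorAlgebra.tprod ℝ _ j v) =
        DirectSum.lof ℝ ℕ (fun n ↦ ⨂[ℝ]^n (TangentSpace 𝓘(ℝ, B) p)) j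
          (PiTensorProduct.tprod ℝ v) :=
      TensorAlgebra.toDirectSum_tensorPower_tprod v
    rw [this, DirectSum.toModule_lof, PiTensorProduct.lift.tprod]
    rfl
  rw [h1]
  refine tensorial_congr (x := p)
    ((LinearMap.applyₗ α ∘ₗ pairAt B F (V := V) p ∘ₗ LinearMap.applyₗ η).compMultilinearMap
      (higherForms covT cov j)) (fun Z i f ↦ ?_) (fun i ↦ extSec p (v i)) Y (fun i ↦ by simp [hY])
  · change pairAt B F p (higherForms covT cov j (update Z i (fmul f (Z i))) η) α =
      f p • pairAt B F p (higherForms covT cov j Z η) α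
    have h3 := higher_tensorial (G := AllForms B F V) (nablaT covT) (nablaForms cov) fmul formsMul
      dirDeriv (nabla_fmul_left covT) (fun f X Y ↦ nabla_fmul covT X f Y)
      (nablaForms_fmul_left cov) (nablaForms_formsMul cov) j Z i f (Z i) η
    rw [update_eq_self] at h3
    rw [h3]
    have h4 : ∀ ζ : AllForms B F V, pairAt B F p (formsMul f ζ) = f p • pairAt B F p ζ :=
      fun ζ ↦ map_smul ExteriorAlgebra.liftAlternating (f p) (fun k ↦ (ζ k).1 p)
    rw [h4]
    rfl

/-- The subspace `P ⊠ Q` of a tensor product. -/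
abbrev box {P Q : Type*} [AddCommGroup P] [Module ℝ P] [AddCommGroup Q] [Module ℝ Q]
    (S : Submodule ℝ P) (T : Submodule ℝ Q) : Submodule ℝ (P ⊗[ℝ] Q) :=
  Submodule.map₂ (TensorProduct.mk ℝ P Q) S T

/-- The tensors of order at most `r`. -/
def tensorLE (W : Type*) [AddCommGroup W] [Module ℝ W] (r : ℕ) :
    Submodule ℝ (TensorAlgebra ℝ W) :=
  ⨆ i ≤ r, LinearMap.range (TensorAlgebra.ι ℝ (M := W)) ^ i

/-- The symmetric tensors of order at most `r`. -/
def symLE (W : Type*) [AddCommGroup W] [Module ℝ W] (r : ℕ) :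
    Submodule ℝ (SymmetricAlgebra ℝ W) :=
  ⨆ i ≤ r, LinearMap.range (SymmetricAlgebra.ι ℝ W) ^ i

/-- `U_k^r(V;p)`, the image of `⊗^{≤r}(T_pM) ⊠ ∧^k(V_p)` under `Φ_p`. Functionals on sections of
`∧^k(V*)` are regarded as functionals on sections of `∧(V*)` that vanish on the other degrees. -/
def U (p : M) (r k : ℕ) : Submodule ℝ (Module.Dual ℝ (AllForms B F V)) :=
  (box (tensorLE (TangentSpace 𝓘(ℝ, B) p) r) (⋀[ℝ]^k (V p))).map (Phi covT cov p)

/-- `U(V;p)`, the sum of the spaces `U_k^r(V;p)`. -/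
def UTotal (p : M) : Submodule ℝ (Module.Dual ℝ (AllForms B F V)) :=
  ⨆ (r : ℕ) (k : ℕ), U covT cov p r k

variable (B V) in
/-- The natural projection `⊗(T_pM) ⊠ ∧(V_p) → S(T_pM) ⊠ ∧(V_p)`. -/
def toSym (p : M) :
    TensorAlgebra ℝ (TangentSpace 𝓘(ℝ, B) p) ⊗[ℝ] ExteriorAlgebra ℝ (V p) →ₗ[ℝ]
      SymmetricAlgebra ℝ (TangentSpace 𝓘(ℝ, B) p) ⊗[ℝ] ExteriorAlgebra ℝ (V p) :=
  TensorProduct.map (SymmetricAlgebra.algHom ℝ (TangentSpace 𝓘(ℝ, B) p)).toLinearMap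
    LinearMap.id

/-- `ker Φ_p` is a two-sided ideal of the algebra `⊗(T_pM) ⊠ ∧(V_p)`. -/
def KerIsIdeal (p : M) : Prop :=
  ∃ J : TwoSidedIdeal
      (TensorAlgebra ℝ (TangentSpace 𝓘(ℝ, B) p) ⊗[ℝ] ExteriorAlgebra ℝ (V p)),
    ∀ z, z ∈ J ↔ z ∈ LinearMap.ker (Phi covT cov p)

/-- `Φ_p` factors through `S(T_pM) ⊠ ∧(V_p)`. -/
def FactorsThroughSym (p : M) : Prop :=
  ∃ Ψ : SymmetricAlgebra ℝ (TangentSpace 𝓘(ℝ, B) p) ⊗[ℝ] ExteriorAlgebra ℝ (V p) →ₗ[ℝ]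
      Module.Dual ℝ (AllForms B F V),
    Phi covT cov p = Ψ ∘ₗ toSym B V p

end Phi

end CovJet

end

/-! Collect all `∇^j` into one linear map `H` on the tensor algebra of the space of global vector
fields. Its recursion is `H(X ⊗ t) = ∇_X H(t) - H(D_X t)`, where `D_X` is the derivation of the
tensor algebra extending `∇̂_X`. Applying it twice gives the Ricci identity `H([a,b] ⊗ w) = R_{a,b}
H(w) - H(R^{TM}_{a,b} · w)`, where `[a,b] = a ⊗ b - b ⊗ a` and `R` is the curvature of `∧(E*)`
(`higherTensor_commutator_mul`). Since `∇̂` is torsion-free, `R` vanishes on functions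
(`curvEnd_dirDerivLin`), so on forms it is minus the transpose of `R^E` (`formTensor_curvEnd`).

3 ⇔ 2. The kernel of `⊗ → S` is the two-sided ideal generated by the commutators, so 3 says that
`H(v ⊗ [a,b] ⊗ w) η` vanishes at `p` for all `v, a, b, w, η`. Letting `v` vary amounts to
differentiating, so this means that `H([a,b] ⊗ w) η` vanishes to infinite order at `p`. By the Ricci
identity this follows if `R^E` and `R^{TM}` vanish to infinite order. Conversely `w = 1` isolates
`R^E`, and `w = c` with a function `f` for `η` isolates the derivative of `f` along `R^{TM}_{a,b}
c`. Asymptotic flatness is the same vanishing to infinite order, because the induced connection on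
`Hom(TM ⊗ TM ⊗ E, E)` obeys the Leibniz rule.

1 ⇒ 3. Pairing with `1 ∈ ∧(E_p)` sees only the component of degree zero, a function, which has no
curvature. So `[a,b] ⊠ 1` always lies in `ker Φ_p`; if the kernel is an ideal, it contains
everything these elements generate.

3 ⇒ 1 and the isomorphism. Any `Ψ` through which `Φ_p` factors is injective, by a symbol argument.
If `g(p) = 0` and `dg_p = ξ`, then `∇^j(g^r η)` vanishes at `p` for `j < r`, while for `j = r` its
value on `v₁, …, v_r` is `r! ∏ ξ(v_i) η_p`. As `ξ` and `η_p` are arbitrary, this detects the leading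
term of an element of `S ⊠ ∧`. Hence `ker Φ_p` is the kernel of the algebra homomorphism `⊗ ⊠ ∧ → S
⊠ ∧`. -/

noncomputable section

set_option maxSynthPendingDepth 3

namespace CovJet

/-! ### Derivations of the tensor algebra -/

section TensorAlgebra

variable {X : Type*} [AddCommGroup X] [Module ℝ X] {W : Type*} [AddCommGroup W] [Module ℝ W]

open TensorAlgebra (ι tprod)

theorem tprod_succ {j : ℕ} (v : Fin (j + 1) → X) :
    tprod ℝ X (j + 1) v = ι ℝ (v 0) * tprod ℝ X j (Fin.tail v) := by
  simp [TensorAlgebra.tprod_apply, List.ofFn_succ, Fin.tail]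

theorem tprod_cons {j : ℕ} (x : X) (v : Fin j → X) :
    tprod ℝ X (j + 1) (Fin.cons x v) = ι ℝ x * tprod ℝ X j v := by
  rw [tprod_succ, Fin.cons_zero, Fin.tail_cons]

/-- Leibniz-type recursions only control multiplication by a vector on the left. The general
induction principle recovers this one when applied to the operator "multiply on the left by `a`". -/
theorem tensor_left_induction {C : TensorAlgebra ℝ X → Prop} (one : C 1)
    (ι_mul : ∀ x t, C t → C (ι ℝ x * t)) (add : ∀ s t, C s → C t → C (s + t))
    (smul : ∀ (c : ℝ) t, C t → C (c • t)) (t : TensorAlgebra ℝ X) : C t := by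
  have h : ∀ a : TensorAlgebra ℝ X, ∀ t, C t → C (a * t) := by
    intro a
    induction a using TensorAlgebra.induction with
    | algebraMap r => exact fun t ht ↦ by rw [← Algebra.smul_def]; exact smul r t ht
    | ι x => exact ι_mul x
    | mul a b ha hb => exact fun t ht ↦ by rw [mul_assoc]; exact ha _ (hb _ ht)
    | add a b ha hb => exact fun t ht ↦ by rw [add_mul]; exact add _ _ (ha _ ht) (hb _ ht)
  simpa using h t 1 one

theorem tensor_tprod_induction {C : TensorAlgebra ℝ X → Prop}
    (tprod : ∀ j v, C (tprod ℝ X j v)) (add : ∀ s t, C s → C t → C (s + t))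
    (smul : ∀ (c : ℝ) t, C t → C (c • t)) (t : TensorAlgebra ℝ X) : C t := by
  have h : t ∈ Submodule.span ℝ
      {t : TensorAlgebra ℝ X | ∃ j v, t = TensorAlgebra.tprod ℝ X j v} := by
    induction t using tensor_left_induction with
    | one => exact Submodule.subset_span ⟨0, 0, by simp [TensorAlgebra.tprod_apply]⟩
    | ι_mul x t ht =>
      refine Submodule.span_induction (p := fun t _ ↦ ι ℝ x * t ∈ Submodule.span ℝ
        {t : TensorAlgebra ℝ X | ∃ j v, t = TensorAlgebra.tprod ℝ X j v}) ?_ ?_ ?_ ?_ ht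
      · rintro - ⟨j, v, rfl⟩
        exact Submodule.subset_span ⟨j + 1, Fin.cons x v, (tprod_cons x v).symm⟩
      · simp
      · intro s t _ _ hs ht
        rw [mul_add]; exact add_mem hs ht
      · intro c t _ ht
        rw [mul_smul_comm]; exact Submodule.smul_mem _ c ht
    | add s t hs ht => exact add_mem hs ht
    | smul c t ht => exact Submodule.smul_mem _ c ht
  refine Submodule.span_induction (p := fun t _ ↦ C t) ?_ ?_ (fun s t _ _ ↦ add s t)
    (fun c t _ ↦ smul c t) h
  · rintro - ⟨j, v, rfl⟩
    exact tprod j v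
  · simpa using smul 0 _ (tprod 0 0)

/-- The linear map on the tensor algebra with prescribed restrictions to the tensor powers. -/
def ofMultilinear (m : Π j : ℕ, MultilinearMap ℝ (fun _ : Fin j ↦ X) W) :
    TensorAlgebra ℝ X →ₗ[ℝ] W :=
  DirectSum.toModule ℝ ℕ _ (fun j ↦ PiTensorProduct.lift (m j)) ∘ₗ
    (TensorAlgebra.equivDirectSum (R := ℝ) (M := X)).toLinearMap

@[simp]
theorem ofMultilinear_tprod (m : Π j : ℕ, MultilinearMap ℝ (fun _ : Fin j ↦ X) W) {j : ℕ}
    (v : Fin j → X) : ofMultilinear m (tprod ℝ X j v) = m j v := by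
  have : (TensorAlgebra.equivDirectSum (R := ℝ) (M := X)).toLinearMap (tprod ℝ X j v) =
      DirectSum.lof ℝ ℕ (fun n ↦ ⨂[ℝ]^n X) j (PiTensorProduct.tprod ℝ v) :=
    TensorAlgebra.toDirectSum_tensorPower_tprod v
  rw [ofMultilinear, LinearMap.comp_apply, this, DirectSum.toModule_lof,
    PiTensorProduct.lift.tprod]

/-- The algebra homomorphism `t ↦ t + ε D t` to the dual numbers over the tensor algebra, where `D`
is the derivation that extends a linear endomorphism. -/
def tensorDerAux (f : X →ₗ[ℝ] X) :
    TensorAlgebra ℝ X →ₐ[ℝ] TrivSqZeroExt (TensorAlgebra ℝ X) (TensorAlgebra ℝ X) :=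
  TensorAlgebra.lift ℝ
    { toFun := fun x ↦ (ι ℝ x, ι ℝ (f x))
      map_add' := fun x y ↦ by simp only [map_add]; rfl
      map_smul' := fun c x ↦ by simp only [map_smul]; rfl }

/-- The derivation of the tensor algebra that extends a linear endomorphism. -/
def tensorDer (f : X →ₗ[ℝ] X) : TensorAlgebra ℝ X →ₗ[ℝ] TensorAlgebra ℝ X where
  toFun t := (tensorDerAux f t).snd
  map_add' s t := by rw [map_add]; rfl
  map_smul' c t := by rw [map_smul]; rfl

theorem tensorDerAux_fst (f : X →ₗ[ℝ] X) (t : TensorAlgebra ℝ X) :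
    (tensorDerAux f t).fst = t := by
  have : (TrivSqZeroExt.fstHom ℝ (TensorAlgebra ℝ X) (TensorAlgebra ℝ X)).comp (tensorDerAux f) =
      AlgHom.id ℝ _ := by
    ext x
    change (tensorDerAux f (ι ℝ x)).fst = ι ℝ x
    rw [tensorDerAux, TensorAlgebra.lift_ι_apply]
    rfl
  exact AlgHom.congr_fun this t

@[simp]
theorem tensorDer_ι (f : X →ₗ[ℝ] X) (x : X) : tensorDer f (ι ℝ x) = ι ℝ (f x) := by
  change (tensorDerAux f (ι ℝ x)).snd = _
  rw [tensorDerAux, TensorAlgebra.lift_ι_apply]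
  rfl

@[simp]
theorem tensorDer_one (f : X →ₗ[ℝ] X) : tensorDer f 1 = 0 := by
  change (tensorDerAux f 1).snd = 0
  rw [map_one]; rfl

theorem tensorDer_mul (f : X →ₗ[ℝ] X) (s t : TensorAlgebra ℝ X) :
    tensorDer f (s * t) = tensorDer f s * t + s * tensorDer f t := by
  change (tensorDerAux f (s * t)).snd = (tensorDerAux f s).snd * t + s * (tensorDerAux f t).snd
  rw [map_mul, TrivSqZeroExt.snd_mul, tensorDerAux_fst, tensorDerAux_fst, add_comm]
  rfl

theorem tensorDer_tprod (f : X →ₗ[ℝ] X) {j : ℕ} (v : Fin j → X) :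
    tensorDer f (tprod ℝ X j v) = ∑ k, tprod ℝ X j (update v k (f (v k))) := by
  induction j with
  | zero => simp [TensorAlgebra.tprod_apply]
  | succ j ih =>
    rw [tprod_succ, tensorDer_mul, tensorDer_ι, ih, Fin.sum_univ_succ, Finset.mul_sum]
    congr 1
    · rw [tprod_succ, update_self, Fin.tail_update_zero]
    · refine Finset.sum_congr rfl fun k _ ↦ ?_
      rw [tprod_succ, Fin.tail_update_succ, update_of_ne (Fin.succ_ne_zero k).symm]
      rfl

/-- Serves to recognise combinations and commutators of derivations as the derivation of a single
endomorphism. -/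
theorem tensorDer_unique (f : X →ₗ[ℝ] X) (D : TensorAlgebra ℝ X →ₗ[ℝ] TensorAlgebra ℝ X)
    (h1 : D 1 = 0) (h2 : ∀ x t, D (ι ℝ x * t) = ι ℝ (f x) * t + ι ℝ x * D t) :
    D = tensorDer f := by
  ext t
  induction t using tensor_left_induction with
  | one => rw [h1, tensorDer_one]
  | ι_mul x t ht => rw [h2, ht, tensorDer_mul, tensorDer_ι]
  | add s t hs ht => rw [map_add, map_add, hs, ht]
  | smul c t ht => rw [map_smul, map_smul, ht]

end TensorAlgebra

/-! ### Higher covariant derivatives on the tensor algebra and the Ricci identity -/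

section HigherTensor

variable {X : Type*} [AddCommGroup X] [Module ℝ X] {G : Type*} [AddCommGroup G] [Module ℝ G]
  (nT : X →ₗ[ℝ] X →ₗ[ℝ] X) (n : X →ₗ[ℝ] Module.End ℝ G)

open TensorAlgebra (ι tprod)

/-- The higher covariant derivatives as a linear map on the tensor algebra of vector fields. -/
def higherTensor : TensorAlgebra ℝ X →ₗ[ℝ] Module.End ℝ G :=
  ofMultilinear fun j ↦ higherMul nT n j

@[simp]
theorem higherTensor_tprod {j : ℕ} (v : Fin j → X) :
    higherTensor nT n (tprod ℝ X j v) = higherMul nT n j v :=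
  ofMultilinear_tprod _ _

@[simp]
theorem higherTensor_one : higherTensor nT n 1 = 1 := by
  have : (1 : TensorAlgebra ℝ X) = tprod ℝ X 0 0 := by simp [TensorAlgebra.tprod_apply]
  rw [this, higherTensor_tprod]
  rfl

/-- The correction sum in the definition of `∇^{j+1}` is exactly the derivation extending `∇̂_x`,
evaluated on a pure tensor. All later computations use this recursion instead of sums over indices.
-/
theorem higherTensor_ι_mul (x : X) (t : TensorAlgebra ℝ X) :
    higherTensor nT n (ι ℝ x * t) =
      n x * higherTensor nT n t - higherTensor nT n (tensorDer (nT x) t) := by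
  induction t using tensor_tprod_induction with
  | tprod j v =>
    rw [← tprod_cons, tensorDer_tprod, map_sum]
    simp only [higherTensor_tprod]
    ext s
    rw [LinearMap.sub_apply, LinearMap.sum_apply]
    rfl
  | add s t hs ht => simp only [mul_add, map_add, hs, ht]; abel
  | smul c t ht => simp only [mul_smul_comm, map_smul, ht, smul_sub]

/-- The curvature `[∇_a, ∇_b] - ∇_{∇_a b - ∇_b a}`. -/
def curvEnd (a b : X) : Module.End ℝ G := n a * n b - n b * n a - n (nT a b - nT b a)

theorem tensorDer_map_sub (a b : X) :
    tensorDer (n (a - b)) = tensorDer (n a) - tensorDer (n b) := by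
  refine (tensorDer_unique _ _ (by simp) fun x t ↦ ?_).symm
  simp only [LinearMap.sub_apply, tensorDer_mul, tensorDer_ι, map_sub, sub_mul, mul_sub]
  abel

/-- A commutator of derivations is a derivation, so `tensorDer` carries the curvature of `nT` to the
curvature of the induced action on tensors. -/
theorem tensorDer_curvEnd (a b : X) :
    tensorDer (curvEnd nT n a b) =
      tensorDer (n a) ∘ₗ tensorDer (n b) - tensorDer (n b) ∘ₗ tensorDer (n a) -
        tensorDer (n (nT a b - nT b a)) := by
  refine (tensorDer_unique _ _ (by simp) fun x t ↦ ?_).symm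
  simp only [LinearMap.sub_apply, LinearMap.comp_apply, tensorDer_mul, tensorDer_ι, map_add,
    curvEnd, Module.End.mul_apply, map_sub, sub_mul, mul_sub]
  abel

/-- The Ricci identity. -/
theorem higherTensor_commutator_mul (a b : X) (w : TensorAlgebra ℝ X) :
    higherTensor nT n ((ι ℝ a * ι ℝ b - ι ℝ b * ι ℝ a) * w) =
      curvEnd nT n a b * higherTensor nT n w -
        higherTensor nT n (tensorDer (curvEnd nT nT a b) w) := by
  -- Moving both vectors out through the recursion, the mixed terms `∇_a H(D_b w)` and `∇_b H(D_a
  -- w)` cancel in the antisymmetrization.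
  rw [tensorDer_curvEnd, tensorDer_map_sub]
  simp only [sub_mul, mul_assoc, higherTensor_ι_mul, map_sub, map_add, tensorDer_mul, tensorDer_ι,
    LinearMap.sub_apply, LinearMap.comp_apply, curvEnd, mul_sub]
  abel

theorem higherTensor_commutator (a b : X) :
    higherTensor nT n (ι ℝ a * ι ℝ b - ι ℝ b * ι ℝ a) = curvEnd nT n a b := by
  have h := higherTensor_commutator_mul nT n a b 1
  rwa [mul_one, tensorDer_one, map_zero, sub_zero, higherTensor_one, mul_one] at h

theorem higherTensor_ι (x : X) : higherTensor nT n (ι ℝ x) = n x := by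
  have h := higherTensor_ι_mul nT n x 1
  rwa [mul_one, tensorDer_one, map_zero, sub_zero, higherTensor_one, mul_one] at h

end HigherTensor

/-! ### Order of vanishing -/

section Vanishing

variable {X : Type*} {G : Type*} [AddCommGroup G] [Module ℝ G]

/-- The elements of `G` that vanish to order `k`: they and all their iterated derivatives of order
less than `k` lie in `Z`, the space of the elements that vanish. -/
def vanish (n : X → Module.End ℝ G) (Z : Submodule ℝ G) : ℕ → Submodule ℝ G
  | 0 => ⊤
  | k + 1 => Z ⊓ ⨅ x, (vanish n Z k).comap (n x)

variable {n : X → Module.End ℝ G} {Z : Submodule ℝ G}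

theorem mem_vanish_zero (s : G) : s ∈ vanish n Z 0 := Submodule.mem_top

theorem mem_vanish_succ {k : ℕ} {s : G} :
    s ∈ vanish n Z (k + 1) ↔ s ∈ Z ∧ ∀ x, n x s ∈ vanish n Z k := by
  simp [vanish]

theorem vanish_succ_le (k : ℕ) : vanish n Z (k + 1) ≤ vanish n Z k := by
  induction k with
  | zero => exact fun s _ ↦ mem_vanish_zero s
  | succ k ih =>
    intro s hs
    rw [mem_vanish_succ] at hs ⊢
    exact ⟨hs.1, fun x ↦ ih (hs.2 x)⟩

theorem vanish_succ_le_zeros (k : ℕ) : vanish n Z (k + 1) ≤ Z := fun _ hs ↦ (mem_vanish_succ.1 hs).1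

/-- The corrections in `∇^{j+1}` are values of `∇^j` on other vector fields, so `∇^j s` and the
iterated plain derivatives of `s` determine each other. Both inductions need the statement for all
`Y` and all orders at once, since one derivative costs one order. -/
theorem higher_mem_iff [AddCommGroup X] (nT : X → X → X) (s : G) :
    (∀ j Y, higher nT (fun x t ↦ n x t) j Y s ∈ Z) ↔ ∀ k, s ∈ vanish n Z k := by
  constructor
  · intro h k
    suffices H : ∀ j Y, higher nT (fun x t ↦ n x t) j Y s ∈ vanish n Z k from H 0 Fin.elim0
    induction k with
    | zero => exact fun j Y ↦ mem_vanish_zero _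
    | succ k ih =>
      refine fun j Y ↦ mem_vanish_succ.2 ⟨h j Y, fun x ↦ ?_⟩
      have e : n x (higher nT (fun x t ↦ n x t) j Y s) =
          higher nT (fun x t ↦ n x t) (j + 1) (Fin.cons x Y) s +
            ∑ i, higher nT (fun x t ↦ n x t) j (update Y i (nT x (Y i))) s := by
        simp [higher]
      rw [e]
      exact add_mem (ih _ _) (sum_mem fun i _ ↦ ih _ _)
  · intro h j
    suffices H : ∀ j k Y, higher nT (fun x t ↦ n x t) j Y s ∈ vanish n Z k from
      fun Y ↦ vanish_succ_le_zeros 0 (H j 1 Y)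
    intro j
    induction j with
    | zero => exact fun k Y ↦ h k
    | succ j ih =>
      exact fun k Y ↦ sub_mem ((mem_vanish_succ.1 (ih (k + 1) _)).2 _) (sum_mem fun i _ ↦ ih k _)

open TensorAlgebra (ι tprod) in
-- Multiplying by `x` on the left is differentiation along `x` up to the derivation `D_x`, and
-- `D_x(v t) = D_x(v) t + v D_x(t)` remains of the form covered because `S` is stable. Hence testing
-- all left multiples at the point is the same as testing infinite order of vanishing.
theorem higherTensor_mul_mem_iff [AddCommGroup X] [Module ℝ X] (nT : X →ₗ[ℝ] X →ₗ[ℝ] X)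
    (n : X →ₗ[ℝ] Module.End ℝ G) (S : Submodule ℝ (TensorAlgebra ℝ X))
    (hS : ∀ x, ∀ t ∈ S, tensorDer (nT x) t ∈ S) (s : G) :
    (∀ v, ∀ t ∈ S, higherTensor nT n (v * t) s ∈ Z) ↔
      ∀ k, ∀ t ∈ S, higherTensor nT n t s ∈ vanish n Z k := by
  constructor
  · intro h k
    suffices H : ∀ v, ∀ t ∈ S, higherTensor nT n (v * t) s ∈ vanish n Z k from
      fun t ht ↦ by simpa using H 1 t ht
    induction k with
    | zero => exact fun v t _ ↦ mem_vanish_zero _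
    | succ k ih =>
      refine fun v t ht ↦ mem_vanish_succ.2 ⟨h v t ht, fun x ↦ ?_⟩
      have e : n x (higherTensor nT n (v * t) s) = higherTensor nT n (ι ℝ x * v * t) s +
          (higherTensor nT n (tensorDer (nT x) v * t) s +
            higherTensor nT n (v * tensorDer (nT x) t) s) := by
        rw [mul_assoc, higherTensor_ι_mul, tensorDer_mul, map_add]
        simp
      rw [e]
      exact add_mem (ih _ _ ht) (add_mem (ih _ _ ht) (ih _ _ (hS x t ht)))
  · intro h v
    suffices H : ∀ k, ∀ t ∈ S, higherTensor nT n (v * t) s ∈ vanish n Z k from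
      fun t ht ↦ vanish_succ_le_zeros 0 (H 1 t ht)
    induction v using tensor_tprod_induction with
    | tprod j v =>
      induction j with
      | zero => simpa [TensorAlgebra.tprod_apply] using h
      | succ j ih =>
        intro k t ht
        rw [tprod_succ, mul_assoc, higherTensor_ι_mul, tensorDer_mul, tensorDer_tprod, map_add,
          Finset.sum_mul, map_sum]
        simp only [LinearMap.sub_apply, LinearMap.add_apply, LinearMap.sum_apply]
        exact sub_mem ((mem_vanish_succ.1 (ih _ (k + 1) t ht)).2 _)
          (add_mem (sum_mem fun i _ ↦ ih _ k t ht) (ih _ k _ (hS _ t ht)))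
    | add u v hu hv =>
      intro k t ht
      rw [add_mul, map_add]
      exact add_mem (hu k t ht) (hv k t ht)
    | smul c v hv =>
      intro k t ht
      rw [smul_mul_assoc, map_smul]
      exact Submodule.smul_mem _ c (hv k t ht)

end Vanishing

/-! ### Sections, functions and forms vanishing at a point -/

section Geometry

variable {B : Type*} [NormedAddCommGroup B] [NormedSpace ℝ B] [FiniteDimensional ℝ B]
  {M : Type*} [TopologicalSpace M] [T2Space M] [ChartedSpace B M] [IsManifold 𝓘(ℝ, B) ∞ M]
  {F : Type*} [NormedAddCommGroup F] [NormedSpace ℝ F] [FiniteDimensional ℝ F]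
  {V : M → Type*} [TopologicalSpace (TotalSpace F V)]
  [∀ x, AddCommGroup (V x)] [∀ x, Module ℝ (V x)] [∀ x, TopologicalSpace (V x)]
  [∀ x, IsTopologicalAddGroup (V x)] [∀ x, ContinuousSMul ℝ (V x)]
  [FiberBundle F V] [VectorBundle ℝ F V]
  [ContMDiffVectorBundle ∞ F V 𝓘(ℝ, B)]
  (covT : CovariantDerivative 𝓘(ℝ, B) B (TangentSpace 𝓘(ℝ, B) : M → Type _))
  [CovariantDerivative.ContMDiffCovariantDerivative covT ∞]
  (cov : CovariantDerivative 𝓘(ℝ, B) F V)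
  [CovariantDerivative.ContMDiffCovariantDerivative cov ∞]

open TensorAlgebra (ι tprod)

variable (B M) in
/-- The derivative of smooth functions along smooth vector fields as a bilinear map. -/
def dirDerivLin : VecField B M →ₗ[ℝ] Module.End ℝ C^∞⟮𝓘(ℝ, B), M; ℝ⟯ :=
  LinearMap.mk₂ ℝ dirDeriv dirDeriv_add_left dirDeriv_smul_left dirDeriv_add
    (fun c X f ↦ dirDeriv_smul c X f)

@[simp]
theorem dirDerivLin_apply (X : VecField B M) (f : C^∞⟮𝓘(ℝ, B), M; ℝ⟯) :
    dirDerivLin B M X f = dirDeriv X f := rfl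

/-- A connection as a bilinear map on smooth vector fields and smooth sections. -/
def nablaSec : VecField B M →ₗ[ℝ] Module.End ℝ (Sec B F V) :=
  LinearMap.mk₂ ℝ (nabla cov) (nabla_add_left cov) (nabla_smul_left cov) (nabla_add cov)
    (fun c X s ↦ nabla_smul cov X c s)

@[simp]
theorem nablaSec_apply (X : VecField B M) (s : Sec B F V) :
    nablaSec cov X s = nabla cov X s := rfl

variable (B F V) in
/-- The space of smooth sections of `∧(V*)`, as a type of its own. -/
def FormSpace : Type _ := AllForms B F V

instance : AddCommGroup (FormSpace B F V) := inferInstanceAs (AddCommGroup (AllForms B F V))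

instance : Module ℝ (FormSpace B F V) := inferInstanceAs (Module ℝ (AllForms B F V))

/-- The components of a section of `∧(V*)`. -/
def formComp (η : FormSpace B F V) (k : ℕ) : Forms B F V k := (show AllForms B F V from η) k

/-- The section of `∧(V*)` given by a form of degree `k`. -/
def singleForm (k : ℕ) (η : Forms B F V k) : FormSpace B F V := 
  Pi.single (M := fun k ↦ Forms B F V k) k η

theorem formComp_singleForm (k : ℕ) (η : Forms B F V k) : formComp (singleForm k η) k = η :=
  Pi.single_eq_same (M := fun k ↦ Forms B F V k) k η

/-- The connection induced on `∧(V*)`. -/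
def formsConn : VecField B M →ₗ[ℝ] Module.End ℝ (FormSpace B F V) := nablaForms cov

variable (B F) in
/-- The pairing of a section of `∧(V*)` with `∧(V_p)`. -/
def pairing (p : M) : FormSpace B F V →ₗ[ℝ] ExteriorAlgebra ℝ (V p) →ₗ[ℝ] ℝ := pairAt B F p

/-- The product of a smooth function and a section of `∧(V*)`. -/
def formMul (f : C^∞⟮𝓘(ℝ, B), M; ℝ⟯) : FormSpace B F V →+ FormSpace B F V := formsMul f

theorem formsConn_fmul_left (f : C^∞⟮𝓘(ℝ, B), M; ℝ⟯) (X : VecField B M) (η : FormSpace B F V) :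
    formsConn cov (fmul f X) η = formMul f (formsConn cov X η) :=
  nablaForms_fmul_left cov f X η

theorem formsConn_formMul (f : C^∞⟮𝓘(ℝ, B), M; ℝ⟯) (X : VecField B M) (η : FormSpace B F V) :
    formsConn cov X (formMul f η) = formMul f (formsConn cov X η) + formMul (dirDeriv X f) η :=
  nablaForms_formsMul cov f X η

/-- The smooth sections that vanish to order `k` at `p`. -/
abbrev secVanish (p : M) : ℕ → Submodule ℝ (Sec B F V) :=
  vanish (nablaSec cov) (LinearMap.ker (evalAt B F p))

variable (B) in
/-- The smooth functions that vanish to order `k` at `p`. -/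
abbrev funVanish (p : M) : ℕ → Submodule ℝ C^∞⟮𝓘(ℝ, B), M; ℝ⟯ :=
  vanish (dirDerivLin B M) (LinearMap.ker (evalFun p))

/-- The smooth sections of `∧(V*)` that vanish to order `k` at `p`. -/
abbrev formsVanish (p : M) : ℕ → Submodule ℝ (FormSpace B F V) :=
  vanish (formsConn cov) (LinearMap.ker (pairing B F p))

/-- A tensorial operation preserves the order of vanishing. -/
theorem mem_vanish_of_tensorial {G W : Type*} [AddCommGroup G] [Module ℝ G] [AddCommGroup W]
    [Module ℝ W] {p : M} (e : G →ₗ[ℝ] W) (m : C^∞⟮𝓘(ℝ, B), M; ℝ⟯ → G →+ G)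
    (he : ∀ f s, e (m f s) = f p • e s) (n : VecField B M → Module.End ℝ G)
    (hn : ∀ f X s, n X (m f s) = m f (n X s) + m (dirDeriv X f) s)
    (T : Sec B F V →ₗ[ℝ] G) (hT : ∀ f s, T (fmul f s) = m f (T s)) {k : ℕ} {s : Sec B F V}
    (hs : s ∈ secVanish cov p k) : T s ∈ vanish n (LinearMap.ker e) k := by
  induction k generalizing T s with
  | zero => exact mem_vanish_zero _
  | succ k ih =>
    have hs' := mem_vanish_succ.1 hs
    refine mem_vanish_succ.2 ⟨?_, fun X ↦ ?_⟩
    · exact tensorial_zero (e ∘ₗ T) (fun f s ↦ by simp [hT, he]) s hs'.1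
    -- The commutator of `T` with differentiation is again tensorial, because the terms with `X f`
    -- cancel. So the induction runs over all tensorial `T` simultaneously.
    · have h1 := ih (n X ∘ₗ T - T ∘ₗ nablaSec cov X) (fun f s ↦ by
        simp only [LinearMap.sub_apply, LinearMap.comp_apply, nablaSec_apply, nabla_fmul, hT, hn,
          map_add, map_sub]
        abel) (vanish_succ_le k hs)
      have h2 := ih T hT (hs'.2 X)
      simpa using add_mem h1 h2

theorem mem_funVanish_of_tensorial {p : M} (T : Sec B F V →ₗ[ℝ] C^∞⟮𝓘(ℝ, B), M; ℝ⟯)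
    (hT : ∀ f s, T (fmul f s) = f * T s) {k : ℕ} {s : Sec B F V}
    (hs : s ∈ secVanish cov p k) : T s ∈ funVanish B p k :=
  mem_vanish_of_tensorial cov (evalFun p) AddMonoidHom.mulLeft (fun _ _ ↦ rfl) _
    (fun f X s ↦ dirDeriv_mul X f s) T hT hs

theorem pairing_formMul (p : M) (f : C^∞⟮𝓘(ℝ, B), M; ℝ⟯) (η : FormSpace B F V) :
    pairing B F p (formMul f η) = f p • pairing B F p η :=
  map_smul ExteriorAlgebra.liftAlternating (f p) (fun k ↦ (formComp η k).1 p)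

theorem mem_formsVanish_of_tensorial {F' : Type*} [NormedAddCommGroup F'] [NormedSpace ℝ F']
    [FiniteDimensional ℝ F'] {V' : M → Type*} [TopologicalSpace (TotalSpace F' V')]
    [∀ x, AddCommGroup (V' x)] [∀ x, Module ℝ (V' x)] [∀ x, TopologicalSpace (V' x)]
    [∀ x, IsTopologicalAddGroup (V' x)] [∀ x, ContinuousSMul ℝ (V' x)]
    [FiberBundle F' V'] [VectorBundle ℝ F' V'] [ContMDiffVectorBundle ∞ F' V' 𝓘(ℝ, B)]
    (cov' : CovariantDerivative 𝓘(ℝ, B) F' V')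
    [CovariantDerivative.ContMDiffCovariantDerivative cov' ∞]
    {p : M} (T : Sec B F' V' →ₗ[ℝ] FormSpace B F V)
    (hT : ∀ f s, T (fmul f s) = formMul f (T s)) {k : ℕ} {s : Sec B F' V'}
    (hs : s ∈ secVanish cov' p k) : T s ∈ formsVanish cov p k :=
  mem_vanish_of_tensorial (G := FormSpace B F V) cov' (pairing B F p) formMul (pairing_formMul p)
    (formsConn cov) (formsConn_formMul cov) T hT hs

/-! ### Curvature -/

theorem curvEnd_nablaSec_apply (a b : VecField B M) (s : Sec B F V) :
    curvEnd (nablaT covT) (nablaSec cov) a b s = curv covT cov a b s := by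
  have h : ∀ a b : VecField B M, higher (nabla covT) (nabla cov) 2 ![a, b] s =
      nabla cov a (nabla cov b s) - nabla cov (nabla covT a b) s := by
    intro a b
    simp [higher, Fin.tail, update]
  rw [curv, h, h, curvEnd]
  simp only [LinearMap.sub_apply, Module.End.mul_apply, nablaSec_apply, map_sub]
  change _ - (nabla cov (nabla covT a b) s - nabla cov (nabla covT b a) s) = _
  abel

/-- The connection on `Hom(TM ⊗ TM ⊗ V, V)` as a linear map in the section. -/
def nablaHomLin (X : VecField B M) :
    Module.End ℝ (VecField B M → VecField B M → Sec B F V → Sec B F V) where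
  toFun := nablaHom covT cov X
  map_add' S T := by
    funext a b s
    simp only [nablaHom, Pi.add_apply, nabla_add]
    abel
  map_smul' c T := by
    funext a b s
    simp only [nablaHom, Pi.smul_apply, nabla_smul, RingHom.id_apply, smul_sub]

variable (B F V) in
/-- The operations on two vector fields and a section whose values vanish at `p`. -/
def homZeros (p : M) :
    Submodule ℝ (VecField B M → VecField B M → Sec B F V → Sec B F V) where
  carrier := {T | ∀ a b s, T a b s p = 0}
  add_mem' hS hT a b s := by
    exact (congrArg₂ (· + ·) (hS a b s) (hT a b s)).trans (add_zero _)
  zero_mem' _ _ _ := rfl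
  smul_mem' c T hT a b s := by
    exact (congrArg (c • ·) (hT a b s)).trans (smul_zero c)

/-- By the Leibniz rule, `(∇_X T)(a,b,s)` and `∇_X (T(a,b,s))` differ by values of `T` itself, which
are already known to vanish to the lower order. -/
theorem mem_vanish_nablaHomLin {p : M} {k : ℕ}
    {T : VecField B M → VecField B M → Sec B F V → Sec B F V} :
    T ∈ vanish (nablaHomLin covT cov) (homZeros B F V p) k ↔
      ∀ a b s, T a b s ∈ secVanish cov p k := by
  induction k generalizing T with
  | zero => exact ⟨fun _ _ _ _ ↦ mem_vanish_zero _, fun _ ↦ mem_vanish_zero _⟩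
  | succ k ih =>
    constructor
    · intro h a b s
      have h' := mem_vanish_succ.1 h
      have hT := ih.1 (vanish_succ_le k h)
      refine mem_vanish_succ.2 ⟨h'.1 a b s, fun X ↦ ?_⟩
      have h1 : nablaSec cov X (T a b s) = nablaHomLin covT cov X T a b s +
          T (nabla covT X a) b s + T a (nabla covT X b) s + T a b (nabla cov X s) := by
        change nabla cov X _ = nablaHom covT cov X T a b s + _ + _ + _
        rw [nablaHom]; abel
      rw [h1]
      exact add_mem (add_mem (add_mem (ih.1 (h'.2 X) a b s) (hT _ _ _)) (hT _ _ _)) (hT _ _ _)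
    · intro h
      have hT : ∀ a b s, T a b s ∈ secVanish cov p k := fun a b s ↦ vanish_succ_le k (h a b s)
      refine mem_vanish_succ.2 ⟨fun a b s ↦ vanish_succ_le_zeros k (h a b s), fun X ↦ ih.2 ?_⟩
      intro a b s
      exact sub_mem (sub_mem (sub_mem ((mem_vanish_succ.1 (h a b s)).2 X) (hT _ _ _)) (hT _ _ _))
        (hT _ _ _)

/-- Combines the comparison of `∇^j` with plain derivatives and the passage from a tensor to its
values. Flatness thereby becomes a statement about sections of the bundle alone. -/
theorem asympFlat_iff {p : M} :
    AsympFlat covT cov p ↔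
      ∀ k a b s, curvEnd (nablaT covT) (nablaSec cov) a b s ∈ secVanish cov p k := by
  simp only [curvEnd_nablaSec_apply]
  refine Iff.trans ?_ ((higher_mem_iff (n := nablaHomLin covT cov) (Z := homZeros B F V p)
    (nabla covT) (curv covT cov)).trans (forall_congr' fun k ↦ mem_vanish_nablaHomLin covT cov))
  rfl

/-! ### Torsion -/

theorem mlieBracket_eq [CompleteSpace B] (h : covT.torsion = 0) (a b : VecField B M) :
    VectorField.mlieBracket 𝓘(ℝ, B) a b = ⇑(nabla covT a b - nabla covT b a) := by
  funext x
  exact (covT.torsion_eq_zero_iff.1 h (sec_mdiff a x) (sec_mdiff b x)).symm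

/-- The commutator `∇_a b - ∇_b a` of two vector fields. -/
def bracket (a b : VecField B M) : VecField B M := nabla covT a b - nabla covT b a

theorem bracket_add (a b c : VecField B M) :
    bracket covT a (b + c) = bracket covT a b + bracket covT a c := by
  simp only [bracket, nabla_add, nabla_add_left]
  abel

theorem bracket_fmul (a b : VecField B M) (f : C^∞⟮𝓘(ℝ, B), M; ℝ⟯) :
    bracket covT a (fmul f b) = fmul f (bracket covT a b) + fmul (dirDeriv a f) b := by
  rw [bracket, nabla_fmul, nabla_fmul_left, bracket]
  ext x
  change f x • nabla covT a b x + dirDeriv a f x • b x - f x • nabla covT b a x =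
    f x • (nabla covT a b x - nabla covT b a x) + dirDeriv a f x • b x
  rw [smul_sub]
  abel

theorem bracket_jacobi [CompleteSpace B] (h : covT.torsion = 0) (a b c : VecField B M) :
    bracket covT a (bracket covT b c) =
      bracket covT (bracket covT a b) c + bracket covT b (bracket covT a c) := by
  -- Over `ℝ`, `minSmoothness` leaves the order unchanged, so smoothness covers the `C³` manifold
  -- and the `C²` fields that the Jacobi identity requires.
  have h3 : IsManifold 𝓘(ℝ, B) (minSmoothness ℝ 3) M :=
    IsManifold.of_le (n := ∞) (by
      rw [minSmoothness_of_isRCLikeNormedField]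
      exact WithTop.coe_le_coe.2 (le_top : (3 : ℕ∞) ≤ ⊤))
  have hs : ∀ a : VecField B M, ContMDiff 𝓘(ℝ, B) (𝓘(ℝ, B).prod 𝓘(ℝ, B)) (minSmoothness ℝ 2)
      (fun x ↦ TotalSpace.mk' B x (a x)) :=
    fun a ↦ a.contMDiff.of_le (by
      rw [minSmoothness_of_isRCLikeNormedField]
      exact WithTop.coe_le_coe.2 (le_top : (2 : ℕ∞) ≤ ⊤))
  have := VectorField.leibniz_identity_mlieBracket (hs a) (hs b) (hs c)
  simp only [mlieBracket_eq covT h] at this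
  ext x
  exact congrFun this x

/-- This is `[a,b] f = a(b f) - b(a f)`, extracted from the Jacobi identity: written for `(a, b, f
c)` minus `f` times that for `(a, b, c)`, all terms cancel except the difference of the two sides
times `c`. A field `c` that is nonzero at `x` then gives the claim; if the tangent space at `x` is
zero, every term is zero. -/
theorem curvEnd_dirDerivLin [CompleteSpace B] (h : covT.torsion = 0) (a b : VecField B M) :
    curvEnd (nablaT covT) (dirDerivLin B M) a b = 0 := by
  ext f x
  have hdir : ∀ (X : VecField B M) g, X x = 0 → dirDeriv X g x = 0 := fun X g hX ↦ by
    change mvfderiv 𝓘(ℝ, B) g x (X x) = 0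
    rw [hX, map_zero]
  change dirDeriv a (dirDeriv b f) x - dirDeriv b (dirDeriv a f) x -
        dirDeriv (bracket covT a b) f x = 0
  by_cases hv : ∃ v : TangentSpace 𝓘(ℝ, B) x, v ≠ 0
  · obtain ⟨v, hv⟩ := hv
    let c : VecField B M := extSec x v
    have J1 := congrArg (evalAt B B x) (bracket_jacobi covT h a b c)
    have J2 := congrArg (evalAt B B x) (bracket_jacobi covT h a b (fmul f c))
    have he : ∀ (g : C^∞⟮𝓘(ℝ, B), M; ℝ⟯) (X : VecField B M),
      evalAt B B x (fmul g X) = g x • evalAt B B x X := fun _ _ ↦ rfl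
    simp only [bracket_fmul, bracket_add, map_add, he] at J1 J2
    have key : (dirDeriv a (dirDeriv b f) x - dirDeriv b (dirDeriv a f) x -
        dirDeriv (bracket covT a b) f x) • evalAt B B x c = 0 := by
      linear_combination (norm := module) J2 - f x • J1
    rw [show evalAt B B x c = v from extSec_apply_self x v] at key
    exact (smul_eq_zero.1 key).resolve_right hv
  · push Not at hv
    rw [hdir _ _ (hv _), hdir _ _ (hv _), hdir _ _ (hv _), sub_zero, sub_zero]

end Geometry

/-! ### The induced connection and curvature on forms -/

section FormTensor

variable {B : Type*} [NormedAddCommGroup B] [NormedSpace ℝ B] [FiniteDimensional ℝ B]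
  {M : Type*} [TopologicalSpace M] [T2Space M] [ChartedSpace B M] [IsManifold 𝓘(ℝ, B) ∞ M]
  {F : Type*} [NormedAddCommGroup F] [NormedSpace ℝ F] [FiniteDimensional ℝ F]
  {V : M → Type*} [TopologicalSpace (TotalSpace F V)]
  [∀ x, AddCommGroup (V x)] [∀ x, Module ℝ (V x)] [∀ x, TopologicalSpace (V x)]
  [∀ x, IsTopologicalAddGroup (V x)] [∀ x, ContinuousSMul ℝ (V x)]
  [FiberBundle F V] [VectorBundle ℝ F V]
  [ContMDiffVectorBundle ∞ F V 𝓘(ℝ, B)]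
  (covT : CovariantDerivative 𝓘(ℝ, B) B (TangentSpace 𝓘(ℝ, B) : M → Type _))
  [CovariantDerivative.ContMDiffCovariantDerivative covT ∞]
  (cov : CovariantDerivative 𝓘(ℝ, B) F V)
  [CovariantDerivative.ContMDiffCovariantDerivative cov ∞]

open TensorAlgebra (ι tprod)

variable (B F V) in
/-- Evaluation of a section of `∧(V*)` on tensors of smooth sections of `V`. -/
def formTensor : FormSpace B F V →ₗ[ℝ] TensorAlgebra ℝ (Sec B F V) →ₗ[ℝ] C^∞⟮𝓘(ℝ, B), M; ℝ⟯ where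
  toFun η := ofMultilinear fun j ↦ (formAlt (formComp η j)).toMultilinearMap
  map_add' η θ := by
    ext1 t
    induction t using tensor_tprod_induction with
    | tprod j Y => simp only [LinearMap.add_apply, ofMultilinear_tprod]; rfl
    | add s t hs ht => simp only [map_add, hs, ht]
    | smul c t ht => simp only [map_smul, ht]
  map_smul' c η := by
    ext1 t
    induction t using tensor_tprod_induction with
    | tprod j Y => simp only [LinearMap.smul_apply, ofMultilinear_tprod]; rfl
    | add s t hs ht => simp only [map_add, hs, ht]
    | smul c t ht => simp only [map_smul, ht]

theorem formTensor_tprod (η : FormSpace B F V) {j : ℕ} (Y : Fin j → Sec B F V) :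
    formTensor B F V η (tprod ℝ _ j Y) = formApp (formComp η j) Y :=
  ofMultilinear_tprod _ _

/-- The Leibniz rule for the dual connection, in all degrees at once: the sum over arguments is
again a derivation of a tensor algebra, now that of the sections of `V`. -/
theorem formTensor_formsConn (X : VecField B M) (η : FormSpace B F V)
    (t : TensorAlgebra ℝ (Sec B F V)) :
    formTensor B F V (formsConn cov X η) t =
      dirDerivLin B M X (formTensor B F V η t) -
        formTensor B F V η (tensorDer (nablaSec cov X) t) := by
  induction t using tensor_tprod_induction with
  | tprod j Y =>
    rw [tensorDer_tprod, map_sum]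
    simp only [formTensor_tprod]
    exact formApp_nablaForm cov X (formComp η j) Y
  | add s t hs ht => simp only [map_add, hs, ht]; abel
  | smul c t ht => simp only [map_smul, ht, smul_sub]

theorem pairing_eq_zero_iff {p : M} {η : FormSpace B F V} :
    pairing B F p η = 0 ↔ ∀ t, formTensor B F V η t p = 0 := by
  have h : pairing B F p η = 0 ↔ ∀ j, (formComp η j).1 p = 0 := by
    change ExteriorAlgebra.liftAlternatingEquiv (fun j ↦ (formComp η j).1 p) = 0 ↔ _
    rw [LinearEquiv.map_eq_zero_iff]
    exact funext_iff
  rw [h]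
  constructor
  · intro h t
    induction t using tensor_tprod_induction with
    | tprod j Y =>
      rw [formTensor_tprod]
      change (formComp η j).1 p _ = 0
      rw [h]; rfl
    | add s t hs ht =>
      rw [map_add]
      exact (congrArg₂ (· + ·) hs ht).trans (add_zero 0)
    | smul c t ht =>
      rw [map_smul]
      exact (congrArg (c • ·) ht).trans (smul_zero c)
  · refine fun h j ↦ AlternatingMap.ext fun v ↦ ?_
    have := h (tprod ℝ _ j fun i ↦ extSec p (v i))
    rw [formTensor_tprod] at this
    simpa [formApp] using this

/-- Reduces forms to functions: differentiating `η` or its value on `t` differs only by the value of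
the same `η` on another tensor. -/
theorem mem_formsVanish_iff {p : M} {k : ℕ} {η : FormSpace B F V} :
    η ∈ formsVanish cov p k ↔ ∀ t, formTensor B F V η t ∈ funVanish B p k := by
  induction k generalizing η with
  | zero => exact ⟨fun _ _ ↦ mem_vanish_zero _, fun _ ↦ mem_vanish_zero _⟩
  | succ k ih =>
    constructor
    · intro h t
      refine mem_vanish_succ.2 ⟨pairing_eq_zero_iff.1 (vanish_succ_le_zeros k h) t, fun X ↦ ?_⟩
      have h1 := ih.1 ((mem_vanish_succ.1 h).2 X) t
      rw [formTensor_formsConn] at h1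
      simpa using add_mem h1 (ih.1 (vanish_succ_le k h) (tensorDer (nablaSec cov X) t))
    · intro h
      refine mem_vanish_succ.2 ⟨pairing_eq_zero_iff.2 fun t ↦ vanish_succ_le_zeros k (h t),
        fun X ↦ ih.2 fun t ↦ ?_⟩
      rw [formTensor_formsConn]
      exact sub_mem ((mem_vanish_succ.1 (h t)).2 X) (vanish_succ_le k (h _))

/-- The curvature of `∧(V*)` is minus the transpose of the curvature of `V`. -/
theorem formTensor_curvEnd (hT : ∀ a b, curvEnd (nablaT covT) (dirDerivLin B M) a b = 0)
    (a b : VecField B M) (η : FormSpace B F V) (t : TensorAlgebra ℝ (Sec B F V)) :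
    formTensor B F V (curvEnd (nablaT covT) (formsConn cov) a b η) t =
      - formTensor B F V η (tensorDer (curvEnd (nablaT covT) (nablaSec cov) a b) t) := by
  have h := LinearMap.congr_fun (hT a b) (formTensor B F V η t)
  have hc : curvEnd (nablaT covT) (formsConn cov) a b η =
      formsConn cov a (formsConn cov b η) - formsConn cov b (formsConn cov a η) -
        formsConn cov (nablaT covT a b - nablaT covT b a) η := rfl
  have hs : ∀ η θ ζ : FormSpace B F V, formTensor B F V (η - θ - ζ) t =
      formTensor B F V η t - formTensor B F V θ t - formTensor B F V ζ t := fun η θ ζ ↦ by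
    have h1 := LinearMap.congr_fun ((formTensor B F V).map_sub (η - θ) ζ) t
    have h2 := LinearMap.congr_fun ((formTensor B F V).map_sub η θ) t
    exact h1.trans (congrArg (· - formTensor B F V ζ t) h2)
  rw [hc, hs, tensorDer_curvEnd, tensorDer_map_sub]
  simp only [formTensor_formsConn, map_sub, LinearMap.sub_apply, LinearMap.comp_apply, curvEnd,
    Module.End.mul_apply, LinearMap.zero_apply] at h ⊢
  -- What survives of the expansion is the curvature of functions on `η(t)`, which is zero by `h`.
  linear_combination h

/-- Up to sign, the value of the curvature on `Y₁, …, Y_j` is a sum of values of `η` with one `Y_i`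
replaced by `R^E_{a,b} Y_i`. A form is tensorial in each argument, so the order of vanishing passes
on. -/
theorem curvEnd_mem_formsVanish (hT : ∀ a b, curvEnd (nablaT covT) (dirDerivLin B M) a b = 0)
    {p : M} {k : ℕ} (hE : ∀ a b s, curvEnd (nablaT covT) (nablaSec cov) a b s ∈ secVanish cov p k)
    (a b : VecField B M) (η : FormSpace B F V) :
    curvEnd (nablaT covT) (formsConn cov) a b η ∈ formsVanish cov p k := by
  refine (mem_formsVanish_iff cov).2 fun t ↦ ?_
  rw [formTensor_curvEnd covT cov hT]
  refine neg_mem ?_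
  induction t using tensor_tprod_induction with
  | tprod j Y =>
    rw [tensorDer_tprod, map_sum]
    refine sum_mem fun i _ ↦ ?_
    rw [formTensor_tprod]
    exact mem_funVanish_of_tensorial cov ((formAlt (formComp η j)).toMultilinearMap.toLinearMap Y i)
      (fun f s ↦ app_update_fmul (formComp η j) Y i f s) (hE a b (Y i))
  | add s t hs ht => rw [map_add, map_add]; exact add_mem hs ht
  | smul c t ht => rw [map_smul, map_smul]; exact Submodule.smul_mem _ c ht

/-- `∇^j η` in the vector fields, as a linear map on the tensor algebra. -/
abbrev formsTensor :
    TensorAlgebra ℝ (VecField B M) →ₗ[ℝ] Module.End ℝ (FormSpace B F V) :=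
  higherTensor (nablaT covT) (formsConn cov)

/-- Each summand is `∇^j η` with one argument replaced by some `f Y_i`, and `∇^j η` is tensorial in
that argument. This handles the `R^{TM}` term of the Ricci identity. -/
theorem formsTensor_tensorDer_mem {p : M} {k : ℕ} (f : VecField B M →ₗ[ℝ] VecField B M)
    (hf : ∀ X, f X ∈ secVanish covT p k) (w : TensorAlgebra ℝ (VecField B M))
    (η : FormSpace B F V) :
    formsTensor covT cov (tensorDer f w) η ∈ formsVanish cov p k := by
  induction w using tensor_tprod_induction with
  | tprod j Y =>
    rw [tensorDer_tprod, map_sum, LinearMap.sum_apply]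
    refine sum_mem fun i _ ↦ ?_
    rw [higherTensor_tprod]
    refine mem_formsVanish_of_tensorial cov covT
      (LinearMap.applyₗ η ∘ₗ (higherForms covT cov j).toLinearMap Y i) (fun f s ↦ ?_) (hf (Y i))
    have h := higher_tensorial (G := FormSpace B F V) (nablaT covT) (formsConn cov) fmul formMul
      dirDeriv (nabla_fmul_left covT) (fun f X Y ↦ nabla_fmul covT X f Y)
      (formsConn_fmul_left cov) (formsConn_formMul cov) j Y i f s η
    exact h
  | add s t hs ht => rw [map_add, map_add]; exact add_mem hs ht
  | smul c t ht => rw [map_smul, map_smul]; exact Submodule.smul_mem _ c ht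

end FormTensor

/-! ### Existence of test functions and test forms -/

section Existence

variable {B : Type*} [NormedAddCommGroup B] [NormedSpace ℝ B] [FiniteDimensional ℝ B]
  {M : Type*} [TopologicalSpace M] [T2Space M] [ChartedSpace B M] [IsManifold 𝓘(ℝ, B) ∞ M]
  {F : Type*} [NormedAddCommGroup F] [NormedSpace ℝ F] [FiniteDimensional ℝ F]
  {V : M → Type*} [TopologicalSpace (TotalSpace F V)]
  [∀ x, AddCommGroup (V x)] [∀ x, Module ℝ (V x)] [∀ x, TopologicalSpace (V x)]
  [∀ x, IsTopologicalAddGroup (V x)] [∀ x, ContinuousSMul ℝ (V x)]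
  [FiberBundle F V] [VectorBundle ℝ F V]
  [ContMDiffVectorBundle ∞ F V 𝓘(ℝ, B)]
  (covT : CovariantDerivative 𝓘(ℝ, B) B (TangentSpace 𝓘(ℝ, B) : M → Type _))
  [CovariantDerivative.ContMDiffCovariantDerivative covT ∞]
  (cov : CovariantDerivative 𝓘(ℝ, B) F V)
  [CovariantDerivative.ContMDiffCovariantDerivative cov ∞]

open TensorAlgebra (ι tprod)

/-- Each alternating form on the fibre over `p` is the value of a smooth form. -/
theorem exists_form_eq (p : M) {k : ℕ} (A : V p [⋀^Fin k]→ₗ[ℝ] ℝ) :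
    ∃ η : Forms B F V k, η.1 p = A := by
  have : ContMDiffVectorBundle 1 F V 𝓘(ℝ, B) := ContMDiffVectorBundle.of_le (n := ∞) (by simp)
  let t := trivializationAt F V p
  let b := Module.finBasis ℝ F
  have hp : p ∈ t.baseSet := FiberBundle.mem_baseSet_trivializationAt F V p
  obtain ⟨ρ, -, hρ⟩ := (SmoothBumpFunction.nhds_basis_tsupport (I := 𝓘(ℝ, B)) p).mem_iff.1
    (t.open_baseSet.mem_nhds hp)
  -- `L x` identifies the fibre over `x` with that over `p` by matching a local frame; the form
  -- sought is the pullback of `A` along `L`, cut off by `ρ`.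
  let L : Π x, V x →ₗ[ℝ] V p := fun x ↦
    ∑ i, (t.localFrameCoeff 𝓘(ℝ, B) b i x).smulRight (t.localFrame b i p)
  have hL : ∀ x v, L x v = ∑ i, t.localFrameCoeff 𝓘(ℝ, B) b i x v • t.localFrame b i p :=
    fun x v ↦ by simp [L, LinearMap.sum_apply]
  refine ⟨⟨fun x ↦ ρ x • A.compLinearMap (L x), fun Y ↦ ?_⟩, ?_⟩
  · refine contMDiff_of_tsupport fun y hy ↦ ?_
    have hy' : y ∈ t.baseSet := hρ (tsupport_smul_subset_left ρ
      (fun x ↦ A.compLinearMap (L x) fun i ↦ Y i x) hy)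
    have hc : ∀ i j, ContMDiffAt 𝓘(ℝ, B) 𝓘(ℝ, ℝ) ∞
        (fun x ↦ t.localFrameCoeff 𝓘(ℝ, B) b i x (Y j x)) y := fun i j ↦
      (contMDiffOn_baseSet_localFrameCoeff (e := t) b (k := ∞) (s := fun y ↦ Y j y)
        ((Y j).contMDiff.contMDiffOn) i y hy').contMDiffAt (t.open_baseSet.mem_nhds hy')
    have e : (fun x ↦ (ρ x • A.compLinearMap (L x)) fun i ↦ Y i x) = fun x ↦
        ρ x * ∑ r : Fin k → Fin (Module.finrank ℝ F),
          (∏ j, t.localFrameCoeff 𝓘(ℝ, B) b (r j) x (Y j x)) *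
            A fun j ↦ t.localFrame b (r j) p := by
      funext x
      change ρ x * A (fun j ↦ L x (Y j x)) = _
      simp only [hL]
      congr 1
      refine (A.toMultilinearMap.map_sum _).trans (Finset.sum_congr rfl fun r _ ↦ ?_)
      exact A.toMultilinearMap.map_smul_univ _ _
    rw [e]
    exact ρ.contMDiff.contMDiffAt.mul (ContMDiffAt.sum fun r _ ↦
      (ContMDiffAt.prod fun j _ ↦ hc (r j) j).mul contMDiffAt_const)
  · ext v
    have hv : ∀ v : V p, L p v = v := fun v ↦ by
      rw [hL]
      obtain ⟨s, rfl⟩ := evalAt_surjective (B := B) (F := F) (V := V) p v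
      exact (t.eq_sum_localFrameCoeff_smul (I := 𝓘(ℝ, B)) (b := b) (s := s) hp).symm
    change ρ p * A (fun j ↦ L p (v j)) = A v
    simp only [hv]
    rw [ρ.eq_one, one_mul]

/-- Each linear form on `∧(V_p)` is the value of a smooth section of `∧(V*)`. -/
theorem exists_pairing_eq (p : M) (φ : ExteriorAlgebra ℝ (V p) →ₗ[ℝ] ℝ) :
    ∃ η : FormSpace B F V, pairing B F p η = φ := by
  choose η hη using fun k ↦ exists_form_eq (B := B) (F := F) p
    (ExteriorAlgebra.liftAlternatingEquiv.symm φ k)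
  refine ⟨η, ?_⟩
  change ExteriorAlgebra.liftAlternatingEquiv (fun k ↦ (η k).1 p) = φ
  rw [funext hη]
  exact LinearEquiv.apply_symm_apply _ _

/-- Each cotangent vector at `p` is the differential of a smooth function that vanishes at `p`. -/
theorem exists_mvfderiv_eq (p : M) (ℓ : TangentSpace 𝓘(ℝ, B) p →ₗ[ℝ] ℝ) :
    ∃ g : C^∞⟮𝓘(ℝ, B), M; ℝ⟯, g p = 0 ∧ ∀ X : VecField B M, dirDeriv X g p = ℓ (X p) := by
  obtain ⟨D, hD⟩ := isInvertible_mfderiv_extChartAt (I := 𝓘(ℝ, B))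
    (mem_extChartAt_source (I := 𝓘(ℝ, B)) p)
  obtain ⟨ρ, -, -⟩ := (SmoothBumpFunction.nhds_basis_tsupport (I := 𝓘(ℝ, B)) p).mem_iff.1
    Filter.univ_mem
  -- `ℓ` read in the chart at `p`, through the inverse of the differential `D` of the chart.
  let ℓ' : B →L[ℝ] ℝ := LinearMap.toContinuousLinearMap (E := B)
    (ℓ ∘ₗ (D.symm.toLinearEquiv.toLinearMap : B →ₗ[ℝ] B))
  let c : B := extChartAt 𝓘(ℝ, B) p p
  let u : B → ℝ := fun y ↦ ℓ' (y - c)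
  have hu : ContMDiff 𝓘(ℝ, B) 𝓘(ℝ, ℝ) ∞ u :=
    (ℓ'.contDiff.comp (contDiff_id.sub contDiff_const)).contMDiff
  have hs : ContMDiff 𝓘(ℝ, B) 𝓘(ℝ, ℝ) ∞ (fun x ↦ ρ x • u (extChartAt 𝓘(ℝ, B) p x)) :=
    ρ.contMDiff_smul (hu.comp_contMDiffOn contMDiffOn_extChartAt)
  refine ⟨⟨_, hs⟩, ?_, fun X ↦ ?_⟩
  · change ρ p • ℓ' (c - c) = 0
    rw [sub_self, map_zero, smul_zero]
  · change mvfderiv 𝓘(ℝ, B) (fun x ↦ ρ x • u (extChartAt 𝓘(ℝ, B) p x)) p (X p) = _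
    have h1 : (fun x ↦ ρ x • u (extChartAt 𝓘(ℝ, B) p x)) =ᶠ[𝓝 p] u ∘ extChartAt 𝓘(ℝ, B) p := by
      filter_upwards [ρ.eventuallyEq_one] with x hx
      rw [hx]; simp
    have h2 : mvfderiv 𝓘(ℝ, B) (fun x ↦ ρ x • u (extChartAt 𝓘(ℝ, B) p x)) p =
        mvfderiv 𝓘(ℝ, B) (u ∘ extChartAt 𝓘(ℝ, B) p) p := h1.mfderiv_eq
    rw [h2, mvfderiv_comp_apply p (hu.mdifferentiable (by simp) _)
      (mdifferentiableAt_extChartAt (mem_chart_source _ p)), ← hD]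
    have h3 : mvfderiv 𝓘(ℝ, B) u (extChartAt 𝓘(ℝ, B) p p) = ℓ' := by
      change mfderiv 𝓘(ℝ, B) 𝓘(ℝ, ℝ) u c = ℓ'
      rw [mfderiv_eq_fderiv]
      exact (ℓ'.hasFDerivAt.comp c ((hasFDerivAt_id c).sub_const c)).fderiv
    rw [h3]
    exact congrArg ℓ (D.symm_apply_apply (X p))

/-- A section vanishes to order `k` if its pairing with each smooth form does. -/
theorem mem_secVanish_of_formTensor {p : M} {k : ℕ} {s : Sec B F V}
    (h : ∀ η, formTensor B F V η (ι ℝ s) ∈ funVanish B p k) : s ∈ secVanish cov p k := by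
  induction k generalizing s with
  | zero => exact mem_vanish_zero _
  | succ k ih =>
    refine mem_vanish_succ.2 ⟨?_, fun X ↦ ih fun η ↦ ?_⟩
    · refine (Module.forall_dual_apply_eq_zero_iff ℝ _).1 fun φ ↦ ?_
      obtain ⟨η, hη⟩ := exists_form_eq (B := B) (F := F) p
        (AlternatingMap.ofSubsingleton ℝ (V p) ℝ (0 : Fin 1) φ)
      have h1 : formTensor B F V (singleForm 1 η) (ι ℝ s) p = 0 := vanish_succ_le_zeros k (h _)
      have h2 : ι ℝ s = tprod ℝ (Sec B F V) 1 (fun _ ↦ s) := by simp [TensorAlgebra.tprod_apply]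
      rw [h2, formTensor_tprod, formComp_singleForm] at h1
      change η.1 p (fun _ ↦ s p) = 0 at h1
      rw [hη] at h1
      exact h1
    -- Duality: `η(∇_X s) = X(η(s)) - (∇_X η)(s)`, and `∇_X η` is itself one of the forms tested by
    -- `h`.
    · have h1 := (mem_vanish_succ.1 (h η)).2 X
      have h2 := vanish_succ_le k (h (formsConn cov X η))
      rw [formTensor_formsConn, tensorDer_ι] at h2
      simpa using sub_mem h1 h2

/-- A vector field vanishes to order `k` if the derivatives of all smooth functions do. -/
theorem mem_secVanish_of_dirDeriv {p : M} {k : ℕ} {Z : VecField B M}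
    (h : ∀ f, dirDeriv Z f ∈ funVanish B p k) : Z ∈ secVanish covT p k := by
  induction k generalizing Z with
  | zero => exact mem_vanish_zero _
  | succ k ih =>
    have hZ : Z ∈ secVanish covT p k := ih fun f ↦ vanish_succ_le k (h f)
    refine mem_vanish_succ.2 ⟨?_, fun X ↦ ih fun f ↦ ?_⟩
    · refine (Module.forall_dual_apply_eq_zero_iff ℝ _).1 fun φ ↦ ?_
      obtain ⟨g, -, hg⟩ := exists_mvfderiv_eq p φ
      exact (hg Z).symm.trans (vanish_succ_le_zeros k (h g))
    · have h1 := (mem_vanish_succ.1 (h f)).2 X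
      -- The Hessian `Y ↦ X(Y f) - (∇_X Y) f` is tensorial in `Y`, so on `Z` it vanishes to the
      -- order already known for `Z`.
      have h2 := mem_funVanish_of_tensorial covT
        (dirDerivLin B M X ∘ₗ (dirDerivLin B M).flip f -
          (dirDerivLin B M).flip f ∘ₗ nablaSec covT X) (fun g Y ↦ by
            simp only [LinearMap.sub_apply, LinearMap.comp_apply, LinearMap.flip_apply,
              dirDerivLin_apply, nablaSec_apply, dirDeriv_fmul_left, nabla_fmul,
              dirDeriv_add_left, dirDeriv_mul]
            ring) hZ
      simpa using sub_mem h1 h2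

end Existence

/-! ### Commutators and the kernel of the projection to the symmetric algebra -/

section Commutators

variable {X : Type*} [AddCommGroup X] [Module ℝ X]

open TensorAlgebra (ι tprod)

variable (X) in
/-- The right ideal of the tensor algebra generated by the commutators of vectors. -/
def commutatorSpan : Submodule ℝ (TensorAlgebra ℝ X) :=
  Submodule.span ℝ {t | ∃ a b w, t = (ι ℝ a * ι ℝ b - ι ℝ b * ι ℝ a) * w}

/-- A derivation extending an endomorphism of `X` sends a commutator of vectors to a sum of two
such. This is the stability required by `higherTensor_mul_mem_iff`. -/
theorem tensorDer_mem_commutatorSpan (f : X →ₗ[ℝ] X) {t : TensorAlgebra ℝ X}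
    (ht : t ∈ commutatorSpan X) : tensorDer f t ∈ commutatorSpan X := by
  have hc : ∀ a b w, (ι ℝ a * ι ℝ b - ι ℝ b * ι ℝ a) * w ∈ commutatorSpan X := fun a b w ↦
    Submodule.subset_span ⟨a, b, w, rfl⟩
  refine Submodule.span_induction (p := fun t _ ↦ tensorDer f t ∈ commutatorSpan X) ?_ ?_ ?_ ?_ ht
  · rintro - ⟨a, b, w, rfl⟩
    have e : tensorDer f ((ι ℝ a * ι ℝ b - ι ℝ b * ι ℝ a) * w) =
        (ι ℝ (f a) * ι ℝ b - ι ℝ b * ι ℝ (f a)) * w +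
        (ι ℝ a * ι ℝ (f b) - ι ℝ (f b) * ι ℝ a) * w +
        (ι ℝ a * ι ℝ b - ι ℝ b * ι ℝ a) * tensorDer f w := by
      simp only [tensorDer_mul, map_sub, tensorDer_ι, sub_mul, add_mul]
      abel
    rw [e]
    exact add_mem (add_mem (hc _ _ _) (hc _ _ _)) (hc _ _ _)
  · rw [map_zero]; exact zero_mem _
  · intro s t _ _ hs ht
    rw [map_add]; exact add_mem hs ht
  · intro c t _ ht
    rw [map_smul]; exact Submodule.smul_mem _ c ht

theorem higherTensor_commutator_mem_iff {G : Type*} [AddCommGroup G] [Module ℝ G]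
    (nT : X →ₗ[ℝ] X →ₗ[ℝ] X) (n : X →ₗ[ℝ] Module.End ℝ G) (Z : Submodule ℝ G) (s : G) :
    (∀ v a b w, higherTensor nT n (v * (ι ℝ a * ι ℝ b - ι ℝ b * ι ℝ a) * w) s ∈ Z) ↔
      ∀ k a b w, higherTensor nT n ((ι ℝ a * ι ℝ b - ι ℝ b * ι ℝ a) * w) s ∈ vanish n Z k := by
  have hS : ∀ (C : TensorAlgebra ℝ X →ₗ[ℝ] G) (N : Submodule ℝ G),
      (∀ t ∈ commutatorSpan X, C t ∈ N) ↔
        ∀ a b w, C ((ι ℝ a * ι ℝ b - ι ℝ b * ι ℝ a) * w) ∈ N := by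
    refine fun C N ↦ ⟨fun h a b w ↦ h _ (Submodule.subset_span ⟨a, b, w, rfl⟩), fun h t ht ↦ ?_⟩
    have : commutatorSpan X ≤ N.comap C := Submodule.span_le.2 (by
      rintro - ⟨a, b, w, rfl⟩
      exact h a b w)
    exact this ht
  refine Iff.trans ?_ ((higherTensor_mul_mem_iff nT n (commutatorSpan X)
    (fun x t ht ↦ tensorDer_mem_commutatorSpan _ ht) s).trans
      (forall_congr' fun k ↦ hS (LinearMap.applyₗ s ∘ₗ higherTensor nT n) _))
  simp only [mul_assoc]
  exact forall_congr' fun v ↦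
    (hS (LinearMap.applyₗ s ∘ₗ higherTensor nT n ∘ₗ LinearMap.mulLeft ℝ v) Z).symm

/-- A linear map on the tensor algebra that kills the two-sided ideal generated by the commutators
of vectors kills the kernel of the projection to the symmetric algebra. -/
theorem eq_zero_of_algHom_eq_zero {W : Type*} [AddCommGroup W] [Module ℝ W]
    (L : TensorAlgebra ℝ X →ₗ[ℝ] W)
    (hL : ∀ y z a b, L (y * (ι ℝ a * ι ℝ b - ι ℝ b * ι ℝ a) * z) = 0)
    (t : TensorAlgebra ℝ X) (ht : SymmetricAlgebra.algHom ℝ X t = 0) : L t = 0 := by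
  -- The largest two-sided ideal on which `L` vanishes. It contains the generating commutators,
  -- hence the whole kernel.
  let J : TwoSidedIdeal (TensorAlgebra ℝ X) := TwoSidedIdeal.mk' {x | ∀ y z, L (y * x * z) = 0}
    (fun y z ↦ by simp)
    (fun {s t} hs ht y z ↦ by
      have h1 := hs y z
      have h2 := ht y z
      rw [mul_add, add_mul, map_add, h1, h2, add_zero])
    (fun {s} hs y z ↦ by
      have h1 := hs y z
      rw [mul_neg, neg_mul, map_neg, h1, neg_zero])
    (fun {s t} ht y z ↦ by
      have h1 := ht (y * s) z
      rwa [mul_assoc y] at h1)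
    (fun {s t} hs y z ↦ by
      have h1 := hs y (t * z)
      rwa [← mul_assoc, mul_assoc y] at h1)
  have hJ : ∀ x, x ∈ J ↔ ∀ y z, L (y * x * z) = 0 := fun x ↦ TwoSidedIdeal.mem_mk' _ _ _ _ _ _ _
  have hle : TensorAlgebra.symRingCon ℝ X ≤ J.ringCon := by
    refine RingCon.ringConGen_le.2 fun x y h ↦ ?_
    induction h with
    | mul_comm a b => exact (TwoSidedIdeal.rel_iff J _ _).2 ((hJ _).2 fun y z ↦ hL y z a b)
  have h0 : TensorAlgebra.symRingCon ℝ X t 0 := (RingCon.eq _).1 ht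
  simpa using (hJ t).1 ((TwoSidedIdeal.mem_iff J t).2 (hle h0)) 1 1

end Commutators

/-- A linear map that vanishes on the kernel of a surjective linear map factors through it. -/
theorem exists_eq_comp_of_surjective {P Q W : Type*} [AddCommGroup P] [Module ℝ P]
    [AddCommGroup Q] [Module ℝ Q] [AddCommGroup W] [Module ℝ W] (f : P →ₗ[ℝ] Q)
    (hf : Surjective f) (g : P →ₗ[ℝ] W) (h : ∀ x, f x = 0 → g x = 0) :
    ∃ h : Q →ₗ[ℝ] W, g = h ∘ₗ f := by
  obtain ⟨r, hr⟩ := f.exists_rightInverse_of_surjective (LinearMap.range_eq_top.2 hf)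
  refine ⟨g ∘ₗ r, LinearMap.ext fun x ↦ ?_⟩
  rw [← sub_eq_zero]
  change g x - g (r (f x)) = 0
  rw [← map_sub]
  refine h _ ?_
  rw [map_sub, sub_eq_zero]
  exact (LinearMap.congr_fun hr (f x)).symm

/-! ### Factorization through the symmetric algebra and asymptotic flatness -/

section Flatness

variable {B : Type*} [NormedAddCommGroup B] [NormedSpace ℝ B] [FiniteDimensional ℝ B]
  {M : Type*} [TopologicalSpace M] [T2Space M] [ChartedSpace B M] [IsManifold 𝓘(ℝ, B) ∞ M]
  {F : Type*} [NormedAddCommGroup F] [NormedSpace ℝ F] [FiniteDimensional ℝ F]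
  {V : M → Type*} [TopologicalSpace (TotalSpace F V)]
  [∀ x, AddCommGroup (V x)] [∀ x, Module ℝ (V x)] [∀ x, TopologicalSpace (V x)]
  [∀ x, IsTopologicalAddGroup (V x)] [∀ x, ContinuousSMul ℝ (V x)]
  [FiberBundle F V] [VectorBundle ℝ F V]
  [ContMDiffVectorBundle ∞ F V 𝓘(ℝ, B)]
  (covT : CovariantDerivative 𝓘(ℝ, B) B (TangentSpace 𝓘(ℝ, B) : M → Type _))
  [CovariantDerivative.ContMDiffCovariantDerivative covT ∞]
  (cov : CovariantDerivative 𝓘(ℝ, B) F V)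
  [CovariantDerivative.ContMDiffCovariantDerivative cov ∞]

open TensorAlgebra (ι tprod)

variable (B) in
/-- Evaluation of tensors of vector fields at a point. -/
def evTensor (p : M) :
    TensorAlgebra ℝ (VecField B M) →ₐ[ℝ] TensorAlgebra ℝ (TangentSpace 𝓘(ℝ, B) p) :=
  TensorAlgebra.lift ℝ (ι ℝ ∘ₗ evalAt B B p)

@[simp]
theorem evTensor_ι (p : M) (X : VecField B M) : evTensor B p (ι ℝ X) = ι ℝ (X p) :=
  TensorAlgebra.lift_ι_apply _ _

theorem evTensor_commutator (p : M) (a b : VecField B M) :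
    evTensor B p (ι ℝ a * ι ℝ b - ι ℝ b * ι ℝ a) =
      ι ℝ (a p) * ι ℝ (b p) - ι ℝ (b p) * ι ℝ (a p) := by
  rw [map_sub, map_mul, map_mul, evTensor_ι, evTensor_ι]

theorem evTensor_tprod (p : M) {j : ℕ} (Y : Fin j → VecField B M) :
    evTensor B p (tprod ℝ _ j Y) = tprod ℝ _ j fun i ↦ Y i p := by
  rw [TensorAlgebra.tprod_apply, TensorAlgebra.tprod_apply, map_list_prod, List.map_ofFn]
  simp only [Function.comp_def, evTensor_ι]

theorem evTensor_surjective (p : M) : Surjective (evTensor B p) := by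
  intro t
  induction t using TensorAlgebra.induction with
  | algebraMap r => exact ⟨algebraMap ℝ _ r, AlgHom.commutes _ _⟩
  | ι v =>
    obtain ⟨X, hX⟩ := evalAt_surjective (B := B) (F := B) p v
    exact ⟨ι ℝ X, by rw [evTensor_ι]; exact congrArg _ hX⟩
  | mul s t hs ht =>
    obtain ⟨s, rfl⟩ := hs
    obtain ⟨t, rfl⟩ := ht
    exact ⟨s * t, map_mul _ _ _⟩
  | add s t hs ht =>
    obtain ⟨s, rfl⟩ := hs
    obtain ⟨t, rfl⟩ := ht
    exact ⟨s + t, map_add _ _ _⟩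

/-- Transfers questions on `Φ_p` to global vector fields, where the recursion and the Ricci identity
live; tangent vectors at `p` alone cannot be differentiated. -/
theorem Phi_evTensor (p : M) (τ : TensorAlgebra ℝ (VecField B M)) (α : ExteriorAlgebra ℝ (V p))
    (η : FormSpace B F V) :
    Phi covT cov p (evTensor B p τ ⊗ₜ α) (formComp η) =
      pairing B F p (formsTensor covT cov τ η) α := by
  induction τ using tensor_tprod_induction with
  | tprod j Y =>
    rw [evTensor_tprod, Phi_apply covT cov p _ Y (fun _ ↦ rfl), higherTensor_tprod]
    rfl
  | add s t hs ht =>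
    rw [map_add, TensorProduct.add_tmul, map_add, LinearMap.add_apply, hs, ht, map_add,
      LinearMap.add_apply, map_add, LinearMap.add_apply]
  | smul c t ht =>
    rw [map_smul, ← TensorProduct.smul_tmul', map_smul, LinearMap.smul_apply, ht, map_smul,
      LinearMap.smul_apply, map_smul, LinearMap.smul_apply]

theorem factorsThroughSym_iff {p : M} :
    FactorsThroughSym covT cov p ↔ ∀ y z a b (α : ExteriorAlgebra ℝ (V p)),
      Phi covT cov p ((y * (ι ℝ a * ι ℝ b - ι ℝ b * ι ℝ a) * z) ⊗ₜ α) = 0 := by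
  constructor
  · rintro ⟨Ψ, hΨ⟩ y z a b α
    have h : SymmetricAlgebra.algHom ℝ (TangentSpace 𝓘(ℝ, B) p)
        (y * (ι ℝ a * ι ℝ b - ι ℝ b * ι ℝ a) * z) = 0 := by
      simp only [map_mul, map_sub]
      ring
    rw [hΨ, LinearMap.comp_apply, toSym, TensorProduct.map_tmul]
    change Ψ (SymmetricAlgebra.algHom ℝ (TangentSpace 𝓘(ℝ, B) p) _ ⊗ₜ _) = 0
    rw [h, TensorProduct.zero_tmul, map_zero]
  · intro h
    obtain ⟨L, hL⟩ := exists_eq_comp_of_surjective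
      (SymmetricAlgebra.algHom ℝ (TangentSpace 𝓘(ℝ, B) p)).toLinearMap
      (SymmetricAlgebra.algHom_surjective ℝ _) (TensorProduct.curry (Phi covT cov p))
      (eq_zero_of_algHom_eq_zero _ fun y z a b ↦ LinearMap.ext fun α ↦ h y z a b α)
    refine ⟨TensorProduct.lift L, TensorProduct.ext' fun t α ↦ ?_⟩
    exact LinearMap.congr_fun (LinearMap.congr_fun hL t) α

theorem formsTensor_commutator_mem_iff {p : M} (η : FormSpace B F V) :
    (∀ v a b w, formsTensor covT cov (v * (ι ℝ a * ι ℝ b - ι ℝ b * ι ℝ a) * w) η ∈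
        LinearMap.ker (pairing B F p)) ↔
      ∀ k a b w, formsTensor covT cov ((ι ℝ a * ι ℝ b - ι ℝ b * ι ℝ a) * w) η ∈
        formsVanish cov p k :=
  higherTensor_commutator_mem_iff _ _ _ η

theorem factorsThroughSym_iff_mem_ker {p : M} :
    FactorsThroughSym covT cov p ↔ ∀ (η : FormSpace B F V) v a b w,
      formsTensor covT cov (v * (ι ℝ a * ι ℝ b - ι ℝ b * ι ℝ a) * w) η ∈
        LinearMap.ker (pairing B F p) := by
  rw [factorsThroughSym_iff]
  constructor
  · intro h η v a b w
    rw [LinearMap.mem_ker]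
    refine LinearMap.ext fun α ↦ ?_
    rw [← Phi_evTensor, map_mul, map_mul, evTensor_commutator, h, LinearMap.zero_apply,
      LinearMap.zero_apply]
  · intro h y z a b α
    obtain ⟨v, rfl⟩ := evTensor_surjective p y
    obtain ⟨w, rfl⟩ := evTensor_surjective p z
    obtain ⟨a, rfl⟩ := evalAt_surjective (B := B) (F := B) p a
    obtain ⟨b, rfl⟩ := evalAt_surjective (B := B) (F := B) p b
    refine LinearMap.ext fun η ↦ ?_
    have h1 := h (show FormSpace B F V from η) v a b w
    rw [LinearMap.mem_ker] at h1
    have h2 := LinearMap.congr_fun h1 α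
    rw [← Phi_evTensor, map_mul, map_mul, evTensor_commutator] at h2
    exact h2

theorem factorsThroughSym_iff_mem_formsVanish {p : M} :
    FactorsThroughSym covT cov p ↔ ∀ (η : FormSpace B F V) k a b w,
      formsTensor covT cov ((ι ℝ a * ι ℝ b - ι ℝ b * ι ℝ a) * w) η ∈ formsVanish cov p k :=
  (factorsThroughSym_iff_mem_ker covT cov).trans
    (forall_congr' (formsTensor_commutator_mem_iff covT cov))

theorem formsTensor_commutator_mul (a b : VecField B M) (w : TensorAlgebra ℝ (VecField B M))
    (η : FormSpace B F V) :
    formsTensor covT cov ((ι ℝ a * ι ℝ b - ι ℝ b * ι ℝ a) * w) η =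
      curvEnd (nablaT covT) (formsConn cov) a b
        (formsTensor covT cov w η) -
      formsTensor covT cov (tensorDer (curvEnd (nablaT covT) (nablaT covT) a b) w) η := by
  rw [higherTensor_commutator_mul]
  rfl

theorem formsTensor_commutator (a b : VecField B M) (η : FormSpace B F V) :
    formsTensor covT cov (ι ℝ a * ι ℝ b - ι ℝ b * ι ℝ a) η =
      curvEnd (nablaT covT) (formsConn cov) a b η := by
  rw [higherTensor_commutator]

theorem formsTensor_ι (X : VecField B M) (η : FormSpace B F V) :
    formsTensor covT cov (ι ℝ X) η = formsConn cov X η := by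
  rw [higherTensor_ι]

variable (F V) in
/-- A smooth function as a form of degree zero. -/
def zeroForm (f : C^∞⟮𝓘(ℝ, B), M; ℝ⟯) : FormSpace B F V :=
  singleForm 0
    ⟨fun x ↦ AlternatingMap.constOfIsEmpty ℝ (V x) (Fin 0) (f x), fun _ ↦ f.contMDiff⟩

theorem formTensor_zeroForm (f : C^∞⟮𝓘(ℝ, B), M; ℝ⟯) :
    formTensor B F V (zeroForm F V f) 1 = f := by
  have : (1 : TensorAlgebra ℝ (Sec B F V)) = tprod ℝ (Sec B F V) 0 0 := by
    simp [TensorAlgebra.tprod_apply]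
  rw [this, formTensor_tprod, zeroForm, formComp_singleForm]
  rfl

/-- The Ricci identity expresses the condition through `R^E` and `R^{TM}`; special choices of `w`
and `η` separate the two. -/
theorem factorsThroughSym_iff_asympFlat
    (hT : ∀ a b, curvEnd (nablaT covT) (dirDerivLin B M) a b = 0) {p : M} :
    FactorsThroughSym covT cov p ↔ AsympFlat covT covT p ∧ AsympFlat covT cov p := by
  rw [factorsThroughSym_iff_mem_formsVanish, asympFlat_iff, asympFlat_iff]
  constructor
  · refine fun h ↦ ⟨fun k a b c ↦ ?_, fun k a b s ↦ ?_⟩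
    · refine mem_secVanish_of_dirDeriv covT fun f ↦ ?_
      -- For `w = c` and a function `f`, the degree-zero part contains no curvature of forms, and
      -- only `-(R^{TM}_{a,b} c) f` remains.
      have h1 := h (zeroForm F V f) k a b (ι ℝ c)
      rw [formsTensor_commutator_mul, tensorDer_ι, formsTensor_ι, formsTensor_ι] at h1
      have h2 := (mem_formsVanish_iff cov).1 h1 1
      have h3 := LinearMap.congr_fun ((formTensor B F V).map_sub
        (curvEnd (nablaT covT) (formsConn cov) a b
          (formsConn cov c (zeroForm F V f)))
        (formsConn cov (curvEnd (nablaT covT) (nablaT covT) a b c) (zeroForm F V f))) 1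
      have h4 := h3.symm ▸ h2
      rw [LinearMap.sub_apply, formTensor_curvEnd covT cov hT, tensorDer_one, map_zero, neg_zero,
        zero_sub, formTensor_formsConn, tensorDer_one, map_zero, sub_zero,
        formTensor_zeroForm] at h4
      have h5 := neg_mem h4
      rw [neg_neg] at h5
      exact h5
    · refine mem_secVanish_of_formTensor cov fun η ↦ ?_
      -- For `w = 1` the `R^{TM}` term is absent.
      have h1 := h η k a b 1
      rw [mul_one, formsTensor_commutator] at h1
      have h2 := (mem_formsVanish_iff cov).1 h1 (ι ℝ s)
      rw [formTensor_curvEnd covT cov hT, tensorDer_ι] at h2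
      simpa using neg_mem h2
  · rintro ⟨h1, h2⟩ η k a b w
    rw [formsTensor_commutator_mul]
    exact sub_mem (curvEnd_mem_formsVanish covT cov hT (h2 k) a b _)
      (formsTensor_tensorDer_mem covT cov _ (h1 k a b) w η)

/-- If `ker Φ_p` is an ideal, then `Φ_p` factors, since functions have no curvature. -/
theorem KerIsIdeal.factorsThroughSym
    (hT : ∀ a b, curvEnd (nablaT covT) (dirDerivLin B M) a b = 0) {p : M}
    (h : KerIsIdeal covT cov p) : FactorsThroughSym covT cov p := by
  obtain ⟨J, hJ⟩ := h
  rw [factorsThroughSym_iff]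
  intro y z a b α
  have h1 : (ι ℝ a * ι ℝ b - ι ℝ b * ι ℝ a) ⊗ₜ[ℝ] (1 : ExteriorAlgebra ℝ (V p)) ∈ J := by
    rw [hJ]
    obtain ⟨a, rfl⟩ := evalAt_surjective (B := B) (F := B) p a
    obtain ⟨b, rfl⟩ := evalAt_surjective (B := B) (F := B) p b
    refine LinearMap.ext fun η ↦ ?_
    change Phi covT cov p ((ι ℝ (a p) * ι ℝ (b p) - ι ℝ (b p) * ι ℝ (a p)) ⊗ₜ[ℝ] 1)
      (formComp (show FormSpace B F V from η)) = 0
    rw [← evTensor_commutator, Phi_evTensor, formsTensor_commutator]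
    -- Pairing with `1` picks out the component of degree zero, on which the curvature is zero.
    have h2 : ∀ ζ : FormSpace B F V, pairing B F p ζ 1 = formTensor B F V ζ 1 p := by
      intro ζ
      have : (1 : TensorAlgebra ℝ (Sec B F V)) = tprod ℝ (Sec B F V) 0 0 := by
        simp [TensorAlgebra.tprod_apply]
      rw [this, formTensor_tprod]
      refine (ExteriorAlgebra.liftAlternating_one (fun k ↦ (formComp ζ k).1 p)).trans ?_
      exact congrArg ((formComp ζ 0).1 p) (Subsingleton.elim _ _)
    rw [h2, formTensor_curvEnd covT cov hT, tensorDer_one, map_zero, neg_zero]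
    rfl
  have h2 := J.mul_mem_right _ (z ⊗ₜ α) (J.mul_mem_left (y ⊗ₜ 1) _ h1)
  rw [Algebra.TensorProduct.tmul_mul_tmul, Algebra.TensorProduct.tmul_mul_tmul, one_mul,
    one_mul, hJ] at h2
  exact h2

end Flatness

/-! ### Derivatives of powers of a function vanishing at the point -/

section Symbol

variable {B : Type*} [NormedAddCommGroup B] [NormedSpace ℝ B] [FiniteDimensional ℝ B]
  {M : Type*} [TopologicalSpace M] [T2Space M] [ChartedSpace B M] [IsManifold 𝓘(ℝ, B) ∞ M]
  {F : Type*} [NormedAddCommGroup F] [NormedSpace ℝ F] [FiniteDimensional ℝ F]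
  {V : M → Type*} [TopologicalSpace (TotalSpace F V)]
  [∀ x, AddCommGroup (V x)] [∀ x, Module ℝ (V x)] [∀ x, TopologicalSpace (V x)]
  [∀ x, IsTopologicalAddGroup (V x)] [∀ x, ContinuousSMul ℝ (V x)]
  [FiberBundle F V] [VectorBundle ℝ F V]
  [ContMDiffVectorBundle ∞ F V 𝓘(ℝ, B)]
  (covT : CovariantDerivative 𝓘(ℝ, B) B (TangentSpace 𝓘(ℝ, B) : M → Type _))
  [CovariantDerivative.ContMDiffCovariantDerivative covT ∞]
  (cov : CovariantDerivative 𝓘(ℝ, B) F V)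
  [CovariantDerivative.ContMDiffCovariantDerivative cov ∞]

open TensorAlgebra (ι tprod)

section Products

variable {G W : Type*} [AddCommGroup G] [Module ℝ G] [AddCommGroup W] [Module ℝ W] {p : M}
  (e : G →ₗ[ℝ] W) (m : C^∞⟮𝓘(ℝ, B), M; ℝ⟯ → G →+ G)
  (n : VecField B M →ₗ[ℝ] Module.End ℝ G)

/-- Orders of vanishing add up in products. -/
theorem mul_mem_vanish (he : ∀ f s, e (m f s) = f p • e s)
    (hn : ∀ f X s, n X (m f s) = m f (n X s) + m (dirDeriv X f) s) {i j : ℕ}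
    {f : C^∞⟮𝓘(ℝ, B), M; ℝ⟯} {s : G} (hf : f ∈ funVanish B p i)
    (hs : s ∈ vanish n (LinearMap.ker e) j) : m f s ∈ vanish n (LinearMap.ker e) (i + j) := by
  -- Induction on the total order: a derivative of the product lowers the order of one factor by
  -- one. A factor of order zero has no order to lose, and then the other factor gives up one.
  obtain ⟨k, hk⟩ : ∃ k, k = i + j := ⟨_, rfl⟩
  rw [← hk]
  induction k generalizing i j f s with
  | zero => exact mem_vanish_zero _
  | succ k ih =>
    refine mem_vanish_succ.2 ⟨?_, fun X ↦ ?_⟩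
    · rw [LinearMap.mem_ker, he]
      cases i with
      | zero =>
        obtain ⟨j, rfl⟩ : ∃ l, j = l + 1 := ⟨k, by omega⟩
        rw [LinearMap.mem_ker.1 (vanish_succ_le_zeros j hs), smul_zero]
      | succ i =>
        have h : f p = 0 := vanish_succ_le_zeros i hf
        rw [h, zero_smul]
    · rw [hn]
      refine add_mem ?_ ?_
      · cases j with
        | zero =>
          obtain rfl : i = k + 1 := by omega
          exact ih (vanish_succ_le k hf) (mem_vanish_zero _) (by omega)
        | succ j => exact ih hf ((mem_vanish_succ.1 hs).2 X) (by omega)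
      · cases i with
        | zero =>
          obtain rfl : j = k + 1 := by omega
          exact ih (mem_vanish_zero _) (vanish_succ_le k hs) (by omega)
        | succ i => exact ih ((mem_vanish_succ.1 hf).2 X) hs (by omega)

theorem mul_mem_vanish_of_left (he : ∀ f s, e (m f s) = f p • e s)
    (hn : ∀ f X s, n X (m f s) = m f (n X s) + m (dirDeriv X f) s) {i : ℕ}
    {f : C^∞⟮𝓘(ℝ, B), M; ℝ⟯} (hf : f ∈ funVanish B p i) (s : G) :
    m f s ∈ vanish n (LinearMap.ker e) i :=
  mul_mem_vanish e m n he hn hf (mem_vanish_zero s)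

theorem mul_mem_funVanish {i j : ℕ} {f g : C^∞⟮𝓘(ℝ, B), M; ℝ⟯} (hf : f ∈ funVanish B p i)
    (hg : g ∈ funVanish B p j) : f * g ∈ funVanish B p (i + j) :=
  mul_mem_vanish (evalFun p) AddMonoidHom.mulLeft (dirDerivLin B M) (fun _ _ ↦ rfl)
    (fun f X s ↦ dirDeriv_mul X f s) hf hg

theorem pow_mem_funVanish {g : C^∞⟮𝓘(ℝ, B), M; ℝ⟯} (hg : g p = 0) (k : ℕ) :
    g ^ k ∈ funVanish B p k := by
  induction k with
  | zero => exact mem_vanish_zero _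
  | succ k ih =>
    rw [pow_succ]
    exact mul_mem_funVanish ih (mem_vanish_succ.2 ⟨hg, fun _ ↦ mem_vanish_zero _⟩)

theorem dirDeriv_pow_succ (X : VecField B M) (g : C^∞⟮𝓘(ℝ, B), M; ℝ⟯) (k : ℕ) :
    dirDeriv X (g ^ (k + 1)) = (k + 1) • (g ^ k * dirDeriv X g) := by
  induction k with
  | zero => simp
  | succ k ih =>
    rw [pow_succ, dirDeriv_mul, ih]
    simp only [nsmul_eq_mul]
    push_cast
    ring

theorem dirDeriv_nsmul (X : VecField B M) (c : ℕ) (f : C^∞⟮𝓘(ℝ, B), M; ℝ⟯) :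
    dirDeriv X (c • f) = c • dirDeriv X f :=
  map_nsmul (dirDerivLin B M X) c f

end Products

/-- `j` derivatives lower the order of vanishing by at most `j`; the correction terms involve one
derivative fewer and lose less. -/
theorem higherTensor_tprod_mem_vanish {X G : Type*} [AddCommGroup X] [Module ℝ X]
    [AddCommGroup G] [Module ℝ G] (nT : X →ₗ[ℝ] X →ₗ[ℝ] X) (n : X →ₗ[ℝ] Module.End ℝ G)
    (Z : Submodule ℝ G) {j k : ℕ} (Y : Fin j → X) {s : G} (hs : s ∈ vanish n Z (k + j)) :
    higherTensor nT n (tprod ℝ X j Y) s ∈ vanish n Z k := by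
  induction j generalizing k with
  | zero =>
    have : tprod ℝ X 0 Y = 1 := by simp [TensorAlgebra.tprod_apply]
    rw [this, higherTensor_one]
    exact hs
  | succ j ih =>
    rw [tprod_succ, higherTensor_ι_mul, tensorDer_tprod, map_sum, LinearMap.sub_apply,
      Module.End.mul_apply, LinearMap.sum_apply]
    refine sub_mem ((mem_vanish_succ.1 (ih (k := k + 1) _ ?_)).2 (Y 0))
      (sum_mem fun i _ ↦ ih _ (vanish_succ_le _ hs))
    rwa [Nat.add_right_comm]

/-- The leading part of the higher covariant derivatives of `g ^ r η`, where `g` vanishes at `p`. -/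
theorem higherTensor_pow_mul {G W : Type*} [AddCommGroup G] [Module ℝ G] [AddCommGroup W]
    [Module ℝ W] {p : M} (e : G →ₗ[ℝ] W) (m : C^∞⟮𝓘(ℝ, B), M; ℝ⟯ →+ G →+ G)
    (nT : VecField B M →ₗ[ℝ] VecField B M →ₗ[ℝ] VecField B M)
    (n : VecField B M →ₗ[ℝ] Module.End ℝ G) (he : ∀ f s, e (m f s) = f p • e s)
    (hn : ∀ f X s, n X (m f s) = m f (n X s) + m (dirDeriv X f) s)
    {g : C^∞⟮𝓘(ℝ, B), M; ℝ⟯} (hg : g p = 0) (η : G) {j : ℕ} (Y : Fin j → VecField B M) (k : ℕ) :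
    higherTensor nT n (tprod ℝ _ j Y) (m (g ^ (k + j)) η) -
      m ((k + j).descFactorial j • (g ^ k * ∏ i, dirDeriv (Y i) g)) η ∈
        vanish n (LinearMap.ker e) (k + 1) := by
  have hm : ∀ {i f} (s : G), f ∈ funVanish B p i → m f s ∈ vanish n (LinearMap.ker e) i :=
    fun s hf ↦ mul_mem_vanish_of_left e (fun f ↦ m f) n he hn hf s
  induction j generalizing k with
  | zero =>
    have : tprod ℝ (VecField B M) 0 Y = 1 := by simp [TensorAlgebra.tprod_apply]
    rw [this, higherTensor_one]
    simp
  | succ j ih =>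
    rw [tprod_succ, higherTensor_ι_mul, tensorDer_tprod, map_sum, LinearMap.sub_apply,
      Module.End.mul_apply, LinearMap.sum_apply, Fin.prod_univ_succ]
    -- Taken at `k + 1`, so that the error, of order `k + 2`, is still of order `k + 1` after
    -- differentiating along `Y 0`.
    have h1 := ih (Fin.tail Y) (k + 1)
    rw [show k + 1 + j = k + (j + 1) by omega] at h1
    set c := (k + (j + 1)).descFactorial j with hc
    have hc' : (k + (j + 1)).descFactorial (j + 1) = (k + 1) * c := by
      rw [Nat.descFactorial_succ, hc]
      congr 1
      omega
    rw [hc']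
    set P := ∏ i, dirDeriv (Fin.tail Y i) g with hP
    have hP' : ∏ i : Fin j, dirDeriv (Y i.succ) g = P := rfl
    rw [hP']
    set ζ := m (g ^ (k + (j + 1))) η with hζ
    set f := c • (g ^ (k + 1) * P) with hf
    have hfv : f ∈ funVanish B p (k + 1) := by
      rw [hf, ← Nat.cast_smul_eq_nsmul ℝ]
      exact Submodule.smul_mem _ _ (mul_mem_funVanish (j := 0) (pow_mem_funVanish hg _)
        (mem_vanish_zero _))
    have hgv : c • (g ^ (k + 1) * dirDeriv (Y 0) P) ∈ funVanish B p (k + 1) := by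
      rw [← Nat.cast_smul_eq_nsmul ℝ]
      exact Submodule.smul_mem _ _ (mul_mem_funVanish (j := 0) (pow_mem_funVanish hg _)
        (mem_vanish_zero _))
    -- Only the term in which `Y 0` hits the power of `g` drops to order `k`; it supplies the next
    -- factor `k + 1` of the falling factorial.
    have hD : dirDeriv (Y 0) f = c • (g ^ (k + 1) * dirDeriv (Y 0) P) +
        ((k + 1) * c) • (g ^ k * (dirDeriv (Y 0) g * P)) := by
      rw [hf, dirDeriv_nsmul, dirDeriv_mul, dirDeriv_pow_succ]
      simp only [nsmul_eq_mul]
      push_cast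
      ring
    have h2 := (mem_vanish_succ.1 h1).2 (Y 0)
    rw [map_sub, hn, hD, map_add, AddMonoidHom.add_apply] at h2
    have h3 : ∑ i, higherTensor nT n (tprod ℝ _ j
        (update (Fin.tail Y) i (nT (Y 0) (Fin.tail Y i)))) ζ ∈
          vanish n (LinearMap.ker e) (k + 1) :=
      sum_mem fun i _ ↦ higherTensor_tprod_mem_vanish nT n _ _
        (hm η (by rw [show k + 1 + j = k + (j + 1) by omega]; exact pow_mem_funVanish hg _))
    have h4 := sub_mem (add_mem h2 (add_mem (hm (n (Y 0) η) hfv) (hm η hgv))) h3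
    convert h4 using 1
    abel

end Symbol

/-! ### Symmetric tensors and injectivity from leading terms -/

section SymmetricAlgebra

variable {X : Type*} [AddCommGroup X] [Module ℝ X]

open TensorAlgebra (ι tprod)

theorem range_ι_pow_eq_span (j : ℕ) :
    LinearMap.range (ι ℝ (M := X)) ^ j = Submodule.span ℝ (Set.range (tprod ℝ X j)) := by
  refine le_antisymm ?_ (Submodule.span_le.2 ?_)
  · induction j with
    | zero =>
      rw [pow_zero, Submodule.one_le]
      exact Submodule.subset_span ⟨0, by simp [TensorAlgebra.tprod_apply]⟩
    | succ j ih =>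
      rw [pow_succ', Submodule.mul_le]
      rintro - ⟨x, rfl⟩ t ht
      refine Submodule.span_induction (p := fun t _ ↦ ι ℝ x * t ∈ Submodule.span ℝ
        (Set.range (tprod ℝ X (j + 1)))) ?_ ?_ ?_ ?_ (ih ht)
      · rintro - ⟨v, rfl⟩
        exact Submodule.subset_span ⟨Fin.cons x v, tprod_cons x v⟩
      · rw [mul_zero]; exact zero_mem _
      · intro s t _ _ hs ht
        rw [mul_add]; exact add_mem hs ht
      · intro c t _ ht
        rw [mul_smul_comm]; exact Submodule.smul_mem _ c ht
  · rintro - ⟨v, rfl⟩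
    induction j with
    | zero => simp [TensorAlgebra.tprod_apply]
    | succ j ih =>
      rw [tprod_succ, pow_succ']
      exact Submodule.mul_mem_mul ⟨_, rfl⟩ (ih _)

theorem map_range_ι_pow (j : ℕ) :
    (LinearMap.range (ι ℝ (M := X)) ^ j).map (SymmetricAlgebra.algHom ℝ X).toLinearMap =
      LinearMap.range (SymmetricAlgebra.ι ℝ X) ^ j := by
  rw [Submodule.map_pow, ← LinearMap.range_comp]
  rfl

theorem map_tensorLE (r : ℕ) :
    (tensorLE X r).map (SymmetricAlgebra.algHom ℝ X).toLinearMap = symLE X r := by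
  simp only [tensorLE, symLE, Submodule.map_iSup, map_range_ι_pow]

theorem tensorLE_mono : Monotone (tensorLE X) := fun _ _ h ↦
  biSup_mono fun _ hi ↦ hi.trans h

theorem symLE_mono : Monotone (symLE X) := fun _ _ h ↦ biSup_mono fun _ hi ↦ hi.trans h

theorem iSup_tensorLE : ⨆ r, tensorLE X r = ⊤ := by
  refine top_le_iff.1 ?_
  rw [← (DirectSum.Decomposition.isInternal
    (fun i ↦ LinearMap.range (ι ℝ (M := X)) ^ i)).submodule_iSup_eq_top]
  exact iSup_mono fun r ↦ le_iSup₂_of_le r le_rfl le_rfl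

theorem exists_mem_symLE (a : SymmetricAlgebra ℝ X) : ∃ r, a ∈ symLE X r := by
  obtain ⟨t, rfl⟩ := SymmetricAlgebra.algHom_surjective ℝ X a
  have ht : t ∈ ⨆ r, tensorLE X r := iSup_tensorLE (X := X) ▸ Submodule.mem_top
  obtain ⟨r, hr⟩ := (Submodule.mem_iSup_of_directed _ tensorLE_mono.directed_le).1 ht
  exact ⟨r, map_tensorLE (X := X) r ▸ Submodule.mem_map_of_mem hr⟩

theorem symLE_zero : symLE X 0 = LinearMap.range (SymmetricAlgebra.ι ℝ X) ^ 0 := by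
  simp [symLE]

theorem symLE_succ (r : ℕ) :
    symLE X (r + 1) = symLE X r ⊔ LinearMap.range (SymmetricAlgebra.ι ℝ X) ^ (r + 1) := by
  refine le_antisymm (iSup₂_le fun i hi ↦ ?_) (sup_le (symLE_mono r.le_succ)
    (le_iSup₂_of_le (r + 1) le_rfl le_rfl))
  rcases Nat.le_succ_iff.1 hi with h | rfl
  · exact le_sup_of_le_left (le_iSup₂_of_le i h le_rfl)
  · exact le_sup_right

/-- A symmetric tensor is zero if the associated polynomial function on the dual space is. -/
theorem eq_zero_of_forall_lift_eq_zero [FiniteDimensional ℝ X] {a : SymmetricAlgebra ℝ X}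
    (h : ∀ ξ : X →ₗ[ℝ] ℝ, SymmetricAlgebra.lift ξ a = 0) : a = 0 := by
  let b := Module.finBasis ℝ X
  -- In coordinates, `a` is a polynomial and the functionals `ξ` are all the points; over the
  -- infinite field `ℝ` a polynomial that vanishes at every point is zero.
  let φ := SymmetricAlgebra.equivMvPolynomial b
  rw [← φ.map_eq_zero_iff]
  refine MvPolynomial.funext fun x ↦ ?_
  rw [map_zero, ← h (b.constr ℝ x)]
  have : (MvPolynomial.aeval x).comp φ.toAlgHom = SymmetricAlgebra.lift (b.constr ℝ x) := by
    refine SymmetricAlgebra.algHom_ext (b.ext fun i ↦ ?_)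
    simp [φ]
  exact AlgHom.congr_fun this a

/-- A linear map on `S(X) ⊠ W` is injective if there are functionals that read off from its values
the leading terms. -/
theorem injective_of_leading_terms [FiniteDimensional ℝ X] {W D : Type*} [AddCommGroup W]
    [Module ℝ W] [AddCommGroup D] [Module ℝ D] (Ψ : SymmetricAlgebra ℝ X ⊗[ℝ] W →ₗ[ℝ] D)
    (h : ∀ (r : ℕ) (ξ : X →ₗ[ℝ] ℝ) (φ : W →ₗ[ℝ] ℝ), ∃ δ : D →ₗ[ℝ] ℝ,
      (∀ j < r, ∀ a ∈ LinearMap.range (SymmetricAlgebra.ι ℝ X) ^ j, ∀ α, δ (Ψ (a ⊗ₜ α)) = 0) ∧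
      ∀ a ∈ LinearMap.range (SymmetricAlgebra.ι ℝ X) ^ r, ∀ α,
        δ (Ψ (a ⊗ₜ α)) = r.factorial * (SymmetricAlgebra.lift ξ a * φ α)) :
    Injective Ψ := by
  classical
  -- A basis of `W` turns an element of `S(X) ⊠ W` into a finitely supported family `q` of symmetric
  -- tensors.
  let b := Module.Basis.ofVectorSpace ℝ W
  let Q := TensorProduct.equivFinsuppOfBasisRight (M := SymmetricAlgebra ℝ X) b
  have hQ : ∀ q, Q.symm q = q.sum fun i m ↦ m ⊗ₜ b i :=
    TensorProduct.equivFinsuppOfBasisRight_symm_apply b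
  -- The functional for `ξ` and the `i`-th coordinate kills the lower-order parts `l` and the other
  -- basis vectors, leaving `r!` times the value of `a i` at `ξ`. The restriction to `q i ≠ 0` is
  -- needed because the tensor is a sum over the support of `q`.
  have top : ∀ (r : ℕ) (q : _ →₀ SymmetricAlgebra ℝ X) (a : _ → SymmetricAlgebra ℝ X),
      (∀ i, a i ∈ LinearMap.range (SymmetricAlgebra.ι ℝ X) ^ r) →
      (∀ i, ∃ l ∈ ⨆ j < r, LinearMap.range (SymmetricAlgebra.ι ℝ X) ^ j, q i = l + a i) →
      Ψ (Q.symm q) = 0 → ∀ i, q i ≠ 0 → a i = 0 := by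
    intro r q a ha hq h0 i hi
    refine eq_zero_of_forall_lift_eq_zero fun ξ ↦ ?_
    obtain ⟨δ, hδ0, hδ1⟩ := h r ξ (b.coord i)
    have hlow : ∀ l ∈ ⨆ j < r, LinearMap.range (SymmetricAlgebra.ι ℝ X) ^ j, ∀ α,
        δ (Ψ (l ⊗ₜ α)) = 0 := by
      intro l hl α
      have : ⨆ j < r, LinearMap.range (SymmetricAlgebra.ι ℝ X) ^ j ≤
          LinearMap.ker (δ ∘ₗ Ψ ∘ₗ (TensorProduct.mk ℝ _ W).flip α) :=
        iSup₂_le fun j hj a ha ↦ hδ0 j hj a ha α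
      exact this hl
    have h1 : δ (Ψ (Q.symm q)) = 0 := by rw [h0, map_zero]
    have h2 : ∀ k, δ (Ψ (q k ⊗ₜ b k)) =
        if k = i then r.factorial * SymmetricAlgebra.lift ξ (a k) else 0 := by
      intro k
      obtain ⟨l, hl, hk⟩ := hq k
      rw [hk, TensorProduct.add_tmul, map_add, map_add, hlow l hl, zero_add, hδ1 _ (ha k),
        Module.Basis.coord_apply, b.repr_self, Finsupp.single_apply]
      split_ifs <;> simp
    rw [hQ, Finsupp.sum, map_sum, map_sum] at h1
    simp only [h2, Finset.sum_ite_eq', Finsupp.mem_support_iff, ne_eq, hi, not_false_eq_true,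
      if_true] at h1
    exact (mul_eq_zero.1 h1).resolve_left (Nat.cast_ne_zero.2 r.factorial_ne_zero)
  -- Descent on the order: removing the top parts, which are zero by `top`, lowers the bound `r`.
  have main : ∀ (r : ℕ) (q : _ →₀ SymmetricAlgebra ℝ X), (∀ i, q i ∈ symLE X r) →
      Ψ (Q.symm q) = 0 → q = 0 := by
    intro r
    induction r with
    | zero =>
      intro q hq h0
      ext1 i
      by_contra hi
      exact hi (top 0 q q (fun i ↦ symLE_zero (X := X) ▸ hq i)
        (fun i ↦ ⟨0, zero_mem _, (zero_add _).symm⟩) h0 i hi)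
    | succ r ih =>
      intro q hq h0
      simp only [symLE_succ, Submodule.mem_sup] at hq
      choose l hl a ha hla using hq
      refine ih q (fun i ↦ ?_) h0
      by_cases hi : q i = 0
      · rw [hi]; exact zero_mem _
      · have := top (r + 1) q a ha (fun i ↦ ⟨l i, by
          simpa only [symLE, ← Nat.lt_succ_iff] using hl i, (hla i).symm⟩) h0 i hi
        rw [← hla i, this, add_zero]
        exact hl i
  refine (injective_iff_map_eq_zero Ψ).2 fun z hz ↦ ?_
  choose d hd using fun i ↦ exists_mem_symLE (Q z i)
  have h1 := main ((Q z).support.sup d) (Q z) (fun i ↦ ?_) (by rwa [Q.symm_apply_apply])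
  · exact Q.map_eq_zero_iff.1 h1
  · by_cases hi : Q z i = 0
    · rw [hi]; exact zero_mem _
    · exact symLE_mono (Finset.le_sup (Finsupp.mem_support_iff.2 hi)) (hd i)

/-- Pure tensors span each tensor power, and powers of the range of `ι` map onto those in `S(X)`, so
the criterion needs checking only for `Φ` on pure tensors. The test functionals are evaluations at
elements of `G`. -/
theorem injective_of_tprod_leading_terms [FiniteDimensional ℝ X] {W G : Type*} [AddCommGroup W]
    [Module ℝ W] [AddCommMonoid G] [Module ℝ G]
    {Φ : TensorAlgebra ℝ X ⊗[ℝ] W →ₗ[ℝ] Module.Dual ℝ G}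
    {Ψ : SymmetricAlgebra ℝ X ⊗[ℝ] W →ₗ[ℝ] Module.Dual ℝ G}
    (hΨ : Φ = Ψ ∘ₗ TensorProduct.map (SymmetricAlgebra.algHom ℝ X).toLinearMap LinearMap.id)
    (h : ∀ (r : ℕ) (ξ : X →ₗ[ℝ] ℝ) (φ : W →ₗ[ℝ] ℝ), ∃ s : G,
      (∀ j < r, ∀ (v : Fin j → X) α, Φ (tprod ℝ X j v ⊗ₜ α) s = 0) ∧
      ∀ (v : Fin r → X) α, Φ (tprod ℝ X r v ⊗ₜ α) s = r.factorial * ((∏ i, ξ (v i)) * φ α)) :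
    Injective Ψ := by
  refine injective_of_leading_terms Ψ fun r ξ φ ↦ ?_
  obtain ⟨s, h0, h1⟩ := h r ξ φ
  have hs : ∀ t α, Ψ (SymmetricAlgebra.algHom ℝ X t ⊗ₜ α) s = Φ (t ⊗ₜ α) s := fun t α ↦ by
    rw [hΨ]; rfl
  refine ⟨LinearMap.applyₗ s, fun j hj a ha α ↦ ?_, fun a ha α ↦ ?_⟩
  · rw [← map_range_ι_pow, range_ι_pow_eq_span] at ha
    obtain ⟨t, ht, rfl⟩ := ha
    have hle : Submodule.span ℝ (Set.range (tprod ℝ X j)) ≤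
        LinearMap.ker (LinearMap.applyₗ s ∘ₗ Φ ∘ₗ (TensorProduct.mk ℝ _ W).flip α) := by
      refine Submodule.span_le.2 ?_
      rintro - ⟨v, rfl⟩
      exact h0 j hj v α
    exact (hs t α).trans (LinearMap.mem_ker.1 (hle ht))
  · rw [← map_range_ι_pow, range_ι_pow_eq_span] at ha
    obtain ⟨t, ht, rfl⟩ := ha
    have hle : Submodule.span ℝ (Set.range (tprod ℝ X r)) ≤
        LinearMap.eqLocus (LinearMap.applyₗ s ∘ₗ Φ ∘ₗ (TensorProduct.mk ℝ _ W).flip α)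
          ((r.factorial * φ α : ℝ) • ((SymmetricAlgebra.lift ξ).toLinearMap ∘ₗ
            (SymmetricAlgebra.algHom ℝ X).toLinearMap)) := by
      refine Submodule.span_le.2 ?_
      rintro - ⟨v, rfl⟩
      have h2 : SymmetricAlgebra.lift ξ (SymmetricAlgebra.algHom ℝ X (tprod ℝ X r v)) =
          ∏ i, ξ (v i) := by
        rw [TensorAlgebra.tprod_apply, map_list_prod, map_list_prod, List.map_ofFn, List.map_ofFn,
          List.prod_ofFn]
        exact Finset.prod_congr rfl fun i _ ↦ SymmetricAlgebra.lift_ι_apply ξ (v i)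
      refine (h1 v α).trans (Eq.trans ?_ (congrArg ((r.factorial * φ α : ℝ) * ·) h2.symm))
      ring
    refine (hs t α).trans (Eq.trans (hle ht) ?_)
    change r.factorial * φ α * SymmetricAlgebra.lift ξ (SymmetricAlgebra.algHom ℝ X t) =
      r.factorial * (SymmetricAlgebra.lift ξ (SymmetricAlgebra.algHom ℝ X t) * φ α)
    ring

end SymmetricAlgebra

/-! ### Injectivity of the induced map and the isomorphism -/

section Isomorphism

variable {B : Type*} [NormedAddCommGroup B] [NormedSpace ℝ B] [FiniteDimensional ℝ B]
  {M : Type*} [TopologicalSpace M] [T2Space M] [ChartedSpace B M] [IsManifold 𝓘(ℝ, B) ∞ M]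
  {F : Type*} [NormedAddCommGroup F] [NormedSpace ℝ F] [FiniteDimensional ℝ F]
  {V : M → Type*} [TopologicalSpace (TotalSpace F V)]
  [∀ x, AddCommGroup (V x)] [∀ x, Module ℝ (V x)] [∀ x, TopologicalSpace (V x)]
  [∀ x, IsTopologicalAddGroup (V x)] [∀ x, ContinuousSMul ℝ (V x)]
  [FiberBundle F V] [VectorBundle ℝ F V]
  [ContMDiffVectorBundle ∞ F V 𝓘(ℝ, B)]
  (covT : CovariantDerivative 𝓘(ℝ, B) B (TangentSpace 𝓘(ℝ, B) : M → Type _))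
  [CovariantDerivative.ContMDiffCovariantDerivative covT ∞]
  (cov : CovariantDerivative 𝓘(ℝ, B) F V)
  [CovariantDerivative.ContMDiffCovariantDerivative cov ∞]

open TensorAlgebra (ι tprod)

variable (B F V) in
/-- `formMul` as a biadditive map. -/
def formMulHom : C^∞⟮𝓘(ℝ, B), M; ℝ⟯ →+ FormSpace B F V →+ FormSpace B F V :=
  AddMonoidHom.mk' formMul fun f g ↦ AddMonoidHom.ext fun η ↦ funext fun k ↦ Subtype.ext
    (funext fun x ↦ add_smul (f x) (g x) ((formComp η k).1 x))

theorem formMulHom_apply (f : C^∞⟮𝓘(ℝ, B), M; ℝ⟯) (η : FormSpace B F V) :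
    formMulHom B F V f η = formMul f η := rfl

theorem formsTensor_tprod_mem_formsVanish {p : M} {j k : ℕ} (Y : Fin j → VecField B M)
    {η : FormSpace B F V} (h : η ∈ formsVanish cov p (k + j)) :
    formsTensor covT cov (tprod ℝ _ j Y) η ∈ formsVanish cov p k :=
  higherTensor_tprod_mem_vanish _ _ _ Y h

/-- `g ^ r η` vanishes to order `r`, and fewer than `r` derivatives leave positive order of
vanishing. -/
theorem Phi_tprod_pow_of_lt {p : M} {g : C^∞⟮𝓘(ℝ, B), M; ℝ⟯} (hg : g p = 0) {j r : ℕ}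
    (hj : j < r) (v : Fin j → TangentSpace 𝓘(ℝ, B) p) (α : ExteriorAlgebra ℝ (V p))
    (η : FormSpace B F V) :
    Phi covT cov p (tprod ℝ _ j v ⊗ₜ α) (formComp (formMulHom B F V (g ^ r) η)) = 0 := by
  let Y : Fin j → VecField B M := fun i ↦ extSec p (v i)
  have hv : tprod ℝ _ j v = evTensor B p (tprod ℝ _ j Y) := by
    rw [evTensor_tprod]
    simp only [Y, extSec_apply_self]
  obtain ⟨d, rfl⟩ : ∃ d, r = d + 1 + j := ⟨r - j - 1, by omega⟩
  have h1 : formMul (g ^ (d + 1 + j)) η ∈ formsVanish cov p (d + 1 + j) :=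
    mul_mem_vanish_of_left (pairing B F p) formMul (formsConn cov) (pairing_formMul p)
      (formsConn_formMul cov) (pow_mem_funVanish hg _) η
  have h2 : formsTensor covT cov (tprod ℝ _ j Y) (formMul (g ^ (d + 1 + j)) η) ∈
      LinearMap.ker (pairing B F p) :=
    vanish_succ_le_zeros d (formsTensor_tprod_mem_formsVanish covT cov Y h1)
  rw [hv, formMulHom_apply, Phi_evTensor]
  exact LinearMap.congr_fun (LinearMap.mem_ker.1 h2) α

/-- The case `k = 0` of `higherTensor_pow_mul`: the error vanishes at `p`, and the falling factorial
is `r!`. -/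
theorem Phi_tprod_pow {p : M} {g : C^∞⟮𝓘(ℝ, B), M; ℝ⟯} (hg : g p = 0)
    {ξ : TangentSpace 𝓘(ℝ, B) p →ₗ[ℝ] ℝ} (hξ : ∀ X : VecField B M, dirDeriv X g p = ξ (X p))
    {r : ℕ} (v : Fin r → TangentSpace 𝓘(ℝ, B) p) (α : ExteriorAlgebra ℝ (V p))
    (η : FormSpace B F V) :
    Phi covT cov p (tprod ℝ _ r v ⊗ₜ α) (formComp (formMulHom B F V (g ^ r) η)) =
      r.factorial * ((∏ i, ξ (v i)) * pairing B F p η α) := by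
  let Y : Fin r → VecField B M := fun i ↦ extSec p (v i)
  have hv : tprod ℝ _ r v = evTensor B p (tprod ℝ _ r Y) := by
    rw [evTensor_tprod]
    simp only [Y, extSec_apply_self]
  have h1 := vanish_succ_le_zeros 0 (higherTensor_pow_mul (pairing B F p) (formMulHom B F V)
    (nablaT covT) (formsConn cov) (pairing_formMul p) (formsConn_formMul cov) hg η Y 0)
  rw [LinearMap.mem_ker, map_sub, sub_eq_zero, zero_add, Nat.descFactorial_self, pow_zero,
    one_mul] at h1
  have h2 : (r.factorial • ∏ i, dirDeriv (Y i) g : C^∞⟮𝓘(ℝ, B), M; ℝ⟯) p =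
      r.factorial * ∏ i, ξ (v i) := by
    have h3 : (∏ i, dirDeriv (Y i) g : C^∞⟮𝓘(ℝ, B), M; ℝ⟯) p = ∏ i, ξ (v i) := by
      refine (map_prod (ContMDiffMap.evalRingHom (I := 𝓘(ℝ, B)) (n := ∞) (R := ℝ) p) _ _).trans ?_
      refine Finset.prod_congr rfl fun i _ ↦ ?_
      refine (hξ (Y i)).trans ?_
      simp only [Y, extSec_apply_self]
    rw [← h3, ← nsmul_eq_mul]
    exact map_nsmul (evalFun p) r.factorial _
  rw [hv, Phi_evTensor, h1, ← mul_assoc, ← h2]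
  exact LinearMap.congr_fun (pairing_formMul p _ η) α

variable {covT cov} in
/-- A map through which `Φ_p` factors is injective. -/
theorem injective_of_Phi_eq {p : M}
    {Ψ : SymmetricAlgebra ℝ (TangentSpace 𝓘(ℝ, B) p) ⊗[ℝ] ExteriorAlgebra ℝ (V p) →ₗ[ℝ]
      Module.Dual ℝ (AllForms B F V)} (hΨ : Phi covT cov p = Ψ ∘ₗ toSym B V p) :
    Injective Ψ := by
  have : FiniteDimensional ℝ (TangentSpace 𝓘(ℝ, B) p) := inferInstanceAs (FiniteDimensional ℝ B)
  refine injective_of_tprod_leading_terms hΨ fun r ξ φ ↦ ?_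
  obtain ⟨η, rfl⟩ := exists_pairing_eq (B := B) (F := F) p φ
  obtain ⟨g, hg, hξ⟩ := exists_mvfderiv_eq p ξ
  exact ⟨formComp (formMulHom B F V (g ^ r) η),
    fun j hj v α ↦ Phi_tprod_pow_of_lt covT cov hg hj v α η,
    fun v α ↦ Phi_tprod_pow covT cov hg hξ v α η⟩

variable {covT cov} in
-- Since `Ψ` is injective, `ker Φ_p` equals the kernel of `toSym`, and `toSym` is the linear map
-- underlying an algebra homomorphism.
theorem FactorsThroughSym.kerIsIdeal {p : M} (h : FactorsThroughSym covT cov p) :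
    KerIsIdeal covT cov p := by
  obtain ⟨Ψ, hΨ⟩ := h
  refine ⟨TwoSidedIdeal.ker (Algebra.TensorProduct.map
    (SymmetricAlgebra.algHom ℝ (TangentSpace 𝓘(ℝ, B) p))
    (AlgHom.id ℝ (ExteriorAlgebra ℝ (V p)))), fun z ↦ ?_⟩
  rw [TwoSidedIdeal.mem_ker, LinearMap.mem_ker, hΨ, LinearMap.comp_apply,
    map_eq_zero_iff Ψ (injective_of_Phi_eq hΨ)]
  rfl

variable (B V) in
theorem toSym_surjective (p : M) : Surjective (toSym B V p) :=
  TensorProduct.map_surjective (SymmetricAlgebra.algHom_surjective ℝ _) surjective_id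

variable (B V) in
theorem map_toSym_box (p : M) (r k : ℕ) :
    (box (tensorLE (TangentSpace 𝓘(ℝ, B) p) r) (⋀[ℝ]^k (V p))).map (toSym B V p) =
      box (symLE (TangentSpace 𝓘(ℝ, B) p) r) (⋀[ℝ]^k (V p)) := by
  rw [← map_tensorLE, box, box, Submodule.map_map₂]
  conv_rhs => rw [← Submodule.map_id (⋀[ℝ]^k (V p)), Submodule.map₂_map_map]
  rfl

/-- Tensors of bounded order and the homogeneous parts of the exterior algebra exhaust the source of
`Φ_p`, and images commute with sums of subspaces. -/
theorem range_Phi (p : M) : LinearMap.range (Phi covT cov p) = UTotal covT cov p := by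
  have h : ⨆ (r : ℕ) (k : ℕ), box (tensorLE (TangentSpace 𝓘(ℝ, B) p) r) (⋀[ℝ]^k (V p)) = ⊤ := by
    simp only [box, ← Submodule.map₂_iSup_right, ← Submodule.map₂_iSup_left, iSup_tensorLE,
      (DirectSum.Decomposition.isInternal (fun i ↦ ⋀[ℝ]^i (V p))).submodule_iSup_eq_top]
    exact TensorProduct.map₂_mk_top_top_eq_top ℝ _ _
  rw [LinearMap.range_eq_map, ← h]
  simp only [Submodule.map_iSup]
  rfl

variable {covT cov} in
/-- If `Φ_p` factors through `S(T_pM) ⊠ ∧(V_p)`, it descends to an isomorphism onto its image that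
respects the filtrations. -/
theorem FactorsThroughSym.exists_equiv {p : M} (h : FactorsThroughSym covT cov p) :
    ∃ Ψ : SymmetricAlgebra ℝ (TangentSpace 𝓘(ℝ, B) p) ⊗[ℝ] ExteriorAlgebra ℝ (V p) ≃ₗ[ℝ]
        UTotal covT cov p,
      (∀ z, (Ψ (toSym B V p z) : Module.Dual ℝ (AllForms B F V)) = Phi covT cov p z) ∧
      ∀ r k : ℕ, (box (symLE (TangentSpace 𝓘(ℝ, B) p) r) (⋀[ℝ]^k (V p))).map
        ((UTotal covT cov p).subtype ∘ₗ Ψ.toLinearMap) = U covT cov p r k := by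
  obtain ⟨Ψ, hΨ⟩ := h
  have hr : LinearMap.range Ψ = UTotal covT cov p := by
    rw [← range_Phi, hΨ, LinearMap.range_comp_of_range_eq_top _
      (LinearMap.range_eq_top.2 (toSym_surjective B V p))]
  let e := (LinearEquiv.ofInjective Ψ (injective_of_Phi_eq hΨ)).trans (LinearEquiv.ofEq _ _ hr)
  have he : (UTotal covT cov p).subtype ∘ₗ e.toLinearMap = Ψ := rfl
  refine ⟨e, fun z ↦ ?_, fun r k ↦ ?_⟩
  · rw [hΨ]; rfl
  · rw [he, U, hΨ, Submodule.map_comp, map_toSym_box]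

end Isomorphism

end CovJet

end

theorem mainTheorem2 {n : ℕ}
    {M : Type*} [TopologicalSpace M] [T2Space M] [ChartedSpace (EuclideanSpace ℝ (Fin n)) M]
    [IsManifold 𝓘(ℝ, EuclideanSpace ℝ (Fin n)) ∞ M]
    {F : Type*} [NormedAddCommGroup F] [NormedSpace ℝ F] [FiniteDimensional ℝ F]
    {E : M → Type*} [TopologicalSpace (TotalSpace F E)]
    [∀ x, AddCommGroup (E x)] [∀ x, Module ℝ (E x)] [∀ x, TopologicalSpace (E x)]
    [∀ x, IsTopologicalAddGroup (E x)] [∀ x, ContinuousSMul ℝ (E x)]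
    [FiberBundle F E] [VectorBundle ℝ F E]
    [ContMDiffVectorBundle ∞ F E 𝓘(ℝ, EuclideanSpace ℝ (Fin n))]
    (covT : CovariantDerivative 𝓘(ℝ, EuclideanSpace ℝ (Fin n)) (EuclideanSpace ℝ (Fin n))
      (TangentSpace 𝓘(ℝ, EuclideanSpace ℝ (Fin n)) : M → Type _))
    [CovariantDerivative.ContMDiffCovariantDerivative covT ∞]
    (htorsion : covT.torsion = 0)
    (cov : CovariantDerivative 𝓘(ℝ, EuclideanSpace ℝ (Fin n)) F E)
    [CovariantDerivative.ContMDiffCovariantDerivative cov ∞]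
    (p : M) :
    List.TFAE [CovJet.KerIsIdeal covT cov p,
      CovJet.AsympFlat covT covT p ∧ CovJet.AsympFlat covT cov p,
      CovJet.FactorsThroughSym covT cov p] ∧
    (CovJet.KerIsIdeal covT cov p ∨
        (CovJet.AsympFlat covT covT p ∧ CovJet.AsympFlat covT cov p) ∨
        CovJet.FactorsThroughSym covT cov p →
      ∃ Ψ : SymmetricAlgebra ℝ (TangentSpace 𝓘(ℝ, EuclideanSpace ℝ (Fin n)) p) ⊗[ℝ]
          ExteriorAlgebra ℝ (E p) ≃ₗ[ℝ] CovJet.UTotal covT cov p,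
        (∀ z, (Ψ (CovJet.toSym (EuclideanSpace ℝ (Fin n)) E p z) :
          Module.Dual ℝ (CovJet.AllForms (EuclideanSpace ℝ (Fin n)) F E)) =
            CovJet.Phi covT cov p z) ∧
        ∀ r k : ℕ,
          (CovJet.box (CovJet.symLE (TangentSpace 𝓘(ℝ, EuclideanSpace ℝ (Fin n)) p) r)
            (⋀[ℝ]^k (E p))).map ((CovJet.UTotal covT cov p).subtype ∘ₗ Ψ.toLinearMap) =
          CovJet.U covT cov p r k) := by
  have hT := CovJet.curvEnd_dirDerivLin covT htorsion
  have h13 : CovJet.KerIsIdeal covT cov p → CovJet.FactorsThroughSym covT cov p :=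
    CovJet.KerIsIdeal.factorsThroughSym covT cov hT
  have h32 := CovJet.factorsThroughSym_iff_asympFlat covT cov hT (p := p)
  refine ⟨?_, ?_⟩
  · tfae_have 1 → 3 := h13
    tfae_have 3 ↔ 2 := h32
    tfae_have 3 → 1 := CovJet.FactorsThroughSym.kerIsIdeal
    tfae_finish
  · rintro (h | h | h)
    · exact (h13 h).exists_equiv
    · exact (h32.2 h).exists_equiv
    · exact h.exists_equiv
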